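/- Let $E=(E^0,E^1,r,s)$ be an arbitrary directed graph and let $R$ be a commutative ring with unit. Let $L_R(E)$ be the Leavitt path algebra, i.e. the universal (not necessarily unital) $R$-algebra generated by pairwise orthogonal idempotents $v\in E^0$ and elements $e,e^*$ ($e\in E^1$) subject to $s(e)e=e=e\,r(e)$, $r(e)e^*=e^*=e^*s(e)$, $e^*e=r(e)$, $e^*f=0$ for $e\neq f$, and $v=\sum_{s(e)=v}ee^*$ whenever $s^{-1}(v)$ is finite and non-empty. It carries the $R$-linear involution $*$ with $v^*=v$ and $e\mapsto e^*\mapsto e$. Let $G_E=\{\alpha\beta^*:\alpha,\beta\in\mathrm{Path}(E),\ r(\alpha)=r(\beta)\}$ (vertices being paths of length $0$), let $G_E^M=\{x\in G_E: xx^*=x^*x\}$, and let $M_R(E)\subseteq L_R(E)$ be the $R$-subalgebra generated by $G_E^M$. An element of an algebra with involution is positive if it is a finite sum of elements of the form $x^*x$ with $x$ in that algebra. If $\mathcal B$ is an $R$-subalgebra, closed under the involution, of an $R$-algebra $\mathcal A$ with involution, a conditional expectation of $\mathcal A$ onto $\mathcal B$ is an $R$-linear map $\mathbb E:\mathcal A\to\mathcal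 B$ which maps positive elements of $\mathcal A$ to positive elements of $\mathcal B$, is idempotent with image $\mathcal B$, and satisfies $\mathbb E(ba)=b\,\mathbb E(a)$ for all $b\in\mathcal B$, $a\in\mathcal A$. A trail in $E$ is a finite path (possibly of length $0$) whose range is a sink, or an infinite path $e_1e_2\cdots$. An infinite trail is periodic if there are $j,k\ge 1$ with $e_{n+k}=e_n$ for all $n\ge j$; choosing such $j,k$ with $j+k$ minimal, the closed path $e_j\cdots e_{j+k-1}$ is its period. A trail is essentially aperiodic if it is finite, or infinite and not periodic, or periodic with a period $f_1\cdots f_k$ without exits (an exit is an edge $e$ with $s(e)=s(f_i)$ and $e\ne f_i$ for some $i$). Let $\mathfrak T_E$ be the set of essentially aperiodic trails, let $M$ be the free $R$-module with basis $\{\xi_\tau^n:\tau\in\mathfrak T_E,\ n\in\mathbb Z\}$, graded by giving $\xi_\tau^n$ degree $n$, and let $\mathcal E\subseteq\mathrm{End}_R(M)$ be the algebra of finite sums of homogeneous endomorphisms. The aperiodic representation is the homomorphism of $R$-algebras $\Pi_{\rm ap}:L_R(E)\to\mathcal E$ such that $\Pi_{\rm ap}(v)\xi_\tau^n=\xi_\tau^n$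 if $s(\tau)=v$ and $0$ otherwise, $\Pi_{\rm ap}(e)\xi_\tau^n=\xi_{e\tau}^{n+1}$ if $r(e)=s(\tau)$ and $0$ otherwise, and $\Pi_{\rm ap}(e^*)\xi_\tau^n=\xi_\beta^{n-1}$ if $\tau=e\beta$ and $0$ otherwise. For $\tau\in\mathfrak T_E$ let $Q_\tau\in\mathcal E$ be given by $Q_\tau\xi_\tau^n=\xi_\tau^n$ and $Q_\tau\xi_{\tau'}^n=0$ for $\tau'\ne\tau$. The aperiodic conditional expectation $E_{\rm ap}:\mathcal E\to\mathcal E$ is $E_{\rm ap}(T)(m)=\big(\sum_{i=1}^k Q_{\tau_i}TQ_{\tau_i}\big)(m)$, where $\tau_1,\dots,\tau_k\in\mathfrak T_E$ are any distinct trails with $\big(\sum_{i=1}^k Q_{\tau_i}\big)(m)=m$. **Theorem.** There exists a unique conditional expectation $E_M$ of $L_R(E)$ onto $M_R(E)$ such that $$E_M(x)=\begin{cases}x&\text{if }x\in G_E^M,\\ 0&\text{if }x\in G_E\setminus G_E^M.\end{cases}$$ Moreover $\Pi_{\rm ap}\circ E_M=E_{\rm ap}\circ\Pi_{\rm ap}$.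 -/

import Mathlib

universe u v w

noncomputable section

/-! ### Graphs, paths and trails -/

/-- A directed graph with vertex set `V`, edge set `Ed`, source map `s` and range map `r`. No
finiteness or countability is assumed. -/
structure DirectedGraph (V : Type u) (Ed : Type v) where
  s : Ed → V
  r : Ed → V

namespace DirectedGraph

variable {V : Type u} {Ed : Type v} (E : DirectedGraph V Ed)

/-- `v` is a sink if it emits no edges. -/
def IsSink (x : V) : Prop := ∀ e, E.s e ≠ x

/-- The list of edges `l` can be traversed, in this order, starting at the vertex `x`. -/
def IsWalkFrom : V → List Ed → Prop
  | _, [] => True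
  | x, e :: l => E.s e = x ∧ IsWalkFrom (E.r e) l

/-- The vertex reached from `x` after traversing the list of edges `l`. -/
def endFrom : V → List Ed → V
  | x, [] => x
  | _, e :: l => endFrom (E.r e) l

/-- A finite path; the paths of length zero are the vertices. -/
@[ext]
structure Path where
  source : V
  edges : List Ed
  isWalk : E.IsWalkFrom source edges

/-- The range of a path. -/
def Path.range {E : DirectedGraph V Ed} (p : E.Path) : V := E.endFrom p.source p.edges

/-- An exit for the path with edges `l = e₁ … eₙ` is an edge `e` such that `s e = s eᵢ` and `e ≠ eᵢ`
for some `i`. -/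
def HasExit (l : List Ed) : Prop := ∃ f ∈ l, ∃ e, E.s e = E.s f ∧ e ≠ f

/-- A trail is a finite path whose range is a sink, or an infinite path (here `e₁ e₂ …` is
`f 0, f 1, …`). -/
inductive Trail
  | finite (p : E.Path) (h : E.IsSink p.range) : Trail
  | infinite (f : ℕ → Ed) (h : ∀ n, E.r (f n) = E.s (f (n + 1))) : Trail

/-- `k ≥ 1` and the sequence `f` repeats with period `k` from the index `j` on. -/
def IsPeriodicAt (f : ℕ → Ed) (j k : ℕ) : Prop := 1 ≤ k ∧ ∀ n, j ≤ n → f (n + k) = f n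

/-- The pair `(j, k)` has the smallest value `j + k` among those at which `f` is periodic. Then
`f 0 … f (j - 1)` and `f j … f (j + k - 1)` form the seed of `f`, the second one being its period. -/
def IsSeedAt (f : ℕ → Ed) (j k : ℕ) : Prop :=
  IsPeriodicAt f j k ∧ ∀ j' k', IsPeriodicAt f j' k' → j + k ≤ j' + k'

/-- The path `f j … f (j + k - 1)`. -/
def segment (f : ℕ → Ed) (j k : ℕ) : List Ed := (List.range k).map fun i => f (j + i)

/-- A trail is essentially aperiodic if it is finite, or infinite and not periodic, or periodic
with a period without exits. -/
def IsEssentiallyAperiodic : E.Trail → Prop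
  | .finite _ _ => True
  | .infinite f _ =>
      (¬ ∃ j k, IsPeriodicAt f j k) ∨ ∃ j k, IsSeedAt f j k ∧ ¬ E.HasExit (segment f j k)

/-- The set of all essentially aperiodic trails. -/
def EssTrail : Type (max u v) := {τ : E.Trail // E.IsEssentiallyAperiodic τ}

variable {E}

/-- The source of a trail. -/
def Trail.source : E.Trail → V
  | .finite p _ => p.source
  | .infinite f _ => E.s (f 0)

/-- The trail `e τ`, for an edge `e` whose range is the source of the trail `τ`. -/
def Trail.cons (e : Ed) : (τ : E.Trail) → E.r e = τ.source → E.Trail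
  | .finite p h, h' => .finite
      ⟨E.s e, e :: p.edges, rfl, by have := p.isWalk; rw [h']; exact this⟩
      (by
        have h2 : E.IsSink (E.endFrom p.source p.edges) := h
        change E.IsSink (E.endFrom (E.r e) p.edges)
        rw [h']; exact h2)
  | .infinite f h, h' => .infinite (fun n => Nat.casesOn n e f)
      (by
        intro n
        cases n with
        | zero => exact h'
        | succ n => exact h n)

lemma Trail.source_cons (e : Ed) (τ : E.Trail) (h : E.r e = τ.source) :
    (τ.cons e h).source = E.s e := by
  cases τ <;> rfl

lemma Trail.cons_inj {e e' : Ed} {τ τ' : E.Trail} (h : E.r e = τ.source) (h' : E.r e' = τ'.source)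
    (H : τ.cons e h = τ'.cons e' h') : e = e' ∧ τ = τ' := by
  cases τ with
  | finite p hp =>
    cases τ' with
    | finite q hq =>
      simp only [Trail.cons, Trail.finite.injEq] at H
      obtain ⟨he, hl⟩ := List.cons.inj (congrArg Path.edges H)
      subst he
      refine ⟨rfl, ?_⟩
      have : p = q := Path.ext (h.symm.trans h') hl
      subst this
      rfl
    | infinite g hg => simp [Trail.cons] at H
  | infinite f hf =>
    cases τ' with
    | finite q hq => simp [Trail.cons] at H
    | infinite g hg =>
      simp only [Trail.cons, Trail.infinite.injEq] at H
      refine ⟨congrFun H 0, ?_⟩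
      have : f = g := funext fun n => congrFun H (n + 1)
      subst this
      rfl

lemma Trail.exists_cons (τ : E.Trail) (h : ¬ E.IsSink τ.source) :
    ∃ (e : Ed) (β : E.Trail) (hβ : E.r e = β.source), τ = β.cons e hβ := by
  cases τ with
  | finite p hp =>
    obtain ⟨x, l, hl⟩ := p
    cases l with
    | nil => exact absurd hp h
    | cons e l =>
      obtain ⟨rfl, hl⟩ := hl
      exact ⟨e, .finite ⟨E.r e, l, hl⟩ hp, rfl, rfl⟩
  | infinite f hf =>
    refine ⟨f 0, .infinite (fun n => f (n + 1)) (fun n => hf (n + 1)), hf 0, ?_⟩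
    simp only [Trail.cons, Trail.infinite.injEq]
    funext n
    cases n <;> rfl

lemma isPeriodicAt_mul {f : ℕ → Ed} {j k : ℕ} (h : IsPeriodicAt f j k) (m n : ℕ) (hn : j ≤ n) :
    f (n + m * k) = f n := by
  induction m with
  | zero => simp
  | succ m ih =>
    have := h.2 (n + m * k) (by omega)
    rw [← ih, ← this]; congr 1; ring

lemma isEssentiallyAperiodic_infinite (f : ℕ → Ed) (hf : ∀ n, E.r (f n) = E.s (f (n + 1))) :
    E.IsEssentiallyAperiodic (.infinite f hf) ↔
      ∀ j k, IsPeriodicAt f j k → ∀ i, j ≤ i → ∀ e, E.s e = E.s (f i) → e = f i := by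
  constructor
  · rintro (h | ⟨j₀, k₀, h, hx⟩) j k hjk i hi e he
    · exact absurd ⟨j, k, hjk⟩ h
    · have key : ∀ i, j₀ ≤ i → ∀ e, E.s e = E.s (f i) → e = f i := by
        intro i hi e he
        have hk : 0 < k₀ := h.1.1
        have e1 : f i = f (j₀ + (i - j₀) % k₀) := by
          rw [← isPeriodicAt_mul h.1 ((i - j₀) / k₀) (j₀ + (i - j₀) % k₀) (by omega)]
          congr 1
          have := Nat.mod_add_div (i - j₀) k₀
          rw [mul_comm k₀] at this
          omega
        by_contra hne
        refine hx ⟨f i, ?_, e, he, hne⟩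
        simp only [segment, List.mem_map, List.mem_range]
        exact ⟨_, Nat.mod_lt _ hk, e1.symm⟩
      have h1 : f (i + j₀ * k) = f i := isPeriodicAt_mul hjk j₀ i hi
      have h2 : j₀ ≤ i + j₀ * k := by have := Nat.le_mul_of_pos_right j₀ hjk.1; omega
      rw [← h1] at he ⊢
      exact key _ h2 e he
  · intro H
    by_cases hp : ∃ j k, IsPeriodicAt f j k
    · right
      have hp' : ∃ n j k, j + k = n ∧ IsPeriodicAt f j k := by
        obtain ⟨j, k, h⟩ := hp
        exact ⟨_, j, k, rfl, h⟩
      classical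
      obtain ⟨j, k, hn, hjk⟩ := Nat.find_spec hp'
      refine ⟨j, k, ⟨hjk, fun j' k' h' => ?_⟩, ?_⟩
      · rw [hn]; exact Nat.find_min' hp' ⟨j', k', rfl, h'⟩
      · rintro ⟨g, hg, e, he, hne⟩
        simp only [segment, List.mem_map, List.mem_range] at hg
        obtain ⟨i, -, rfl⟩ := hg
        exact hne (H j k hjk (j + i) (by omega) e he)
    · exact Or.inl hp

/-- Adding or removing a first edge does not change whether a trail is essentially aperiodic. -/
lemma isEssentiallyAperiodic_cons (e : Ed) (τ : E.Trail) (h : E.r e = τ.source) :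
    E.IsEssentiallyAperiodic (τ.cons e h) ↔ E.IsEssentiallyAperiodic τ := by
  cases τ with
  | finite p hp => exact Iff.rfl
  | infinite f hf =>
    rw [Trail.cons, isEssentiallyAperiodic_infinite, isEssentiallyAperiodic_infinite]
    constructor
    · intro H j k hjk i hi
      refine H (j + 1) k ⟨hjk.1, fun n hn => ?_⟩ (i + 1) (by omega)
      obtain ⟨m, rfl⟩ : ∃ m, n = m + 1 := ⟨n - 1, by omega⟩
      have e1 : m + 1 + k = (m + k) + 1 := by omega
      rw [e1]
      exact hjk.2 m (by omega)
    · intro H j k hjk i hi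
      have hk := hjk.1
      have hper : IsPeriodicAt f j k := by
        refine ⟨hk, fun n hn => ?_⟩
        have := hjk.2 (n + 1) (by omega)
        have e1 : n + 1 + k = (n + k) + 1 := by omega
        rw [e1] at this
        exact this
      have h1 := hjk.2 i hi
      have e1 : i + k = (i + k - 1) + 1 := by omega
      rw [e1] at h1
      change f (i + k - 1) = (Nat.casesOn i e f : Ed) at h1
      change ∀ e', E.s e' = E.s (Nat.casesOn i e f : Ed) → e' = (Nat.casesOn i e f : Ed)
      rw [← h1]
      exact H j k hper (i + k - 1) (by omega)

/-- The source of an essentially aperiodic trail. -/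
def EssTrail.source (τ : E.EssTrail) : V := τ.1.source

/-- The essentially aperiodic trail `e τ`. -/
def EssTrail.cons (e : Ed) (τ : E.EssTrail) (h : E.r e = τ.source) : E.EssTrail :=
  ⟨τ.1.cons e h, (isEssentiallyAperiodic_cons e τ.1 h).2 τ.2⟩

lemma EssTrail.source_cons (e : Ed) (τ : E.EssTrail) (h : E.r e = τ.source) :
    (τ.cons e h).source = E.s e := Trail.source_cons _ _ _

lemma EssTrail.cons_inj {e e' : Ed} {τ τ' : E.EssTrail} (h : E.r e = τ.source)
    (h' : E.r e' = τ'.source) (H : τ.cons e h = τ'.cons e' h') : e = e' ∧ τ = τ' := by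
  obtain ⟨h1, h2⟩ := Trail.cons_inj h h' (congrArg Subtype.val H)
  exact ⟨h1, Subtype.ext h2⟩

lemma EssTrail.exists_cons (τ : E.EssTrail) (h : ¬ E.IsSink τ.source) :
    ∃ (e : Ed) (β : E.EssTrail) (hβ : E.r e = β.source), τ = β.cons e hβ := by
  obtain ⟨τ, hτ⟩ := τ
  obtain ⟨e, β, hβ, rfl⟩ := Trail.exists_cons τ h
  exact ⟨e, ⟨β, (isEssentiallyAperiodic_cons e β hβ).1 hτ⟩, hβ, rfl⟩

/-! ### The Leavitt path algebra -/

/-- The generators of the Leavitt path algebra: vertices `v`, edges `e` and ghost edges `e*`. -/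
inductive Gen (V : Type u) (Ed : Type v) : Type (max u v)
  | vert (x : V) : Gen V Ed
  | edge (e : Ed) : Gen V Ed
  | ghost (e : Ed) : Gen V Ed

variable (E) in
/-- The defining relations of the Leavitt path algebra of `E`, for a family `g` of elements of a
(not necessarily unital) ring `A`. -/
inductive LeavittRel {A : Type*} [NonUnitalSemiring A] (g : Gen V Ed → A) : A → A → Prop
  | idem (x : V) : LeavittRel g (g (.vert x) * g (.vert x)) (g (.vert x))
  | orth (x y : V) (h : x ≠ y) : LeavittRel g (g (.vert x) * g (.vert y)) 0
  | source_edge (e : Ed) : LeavittRel g (g (.vert (E.s e)) * g (.edge e)) (g (.edge e))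
  | edge_range (e : Ed) : LeavittRel g (g (.edge e) * g (.vert (E.r e))) (g (.edge e))
  | range_ghost (e : Ed) : LeavittRel g (g (.vert (E.r e)) * g (.ghost e)) (g (.ghost e))
  | ghost_source (e : Ed) : LeavittRel g (g (.ghost e) * g (.vert (E.s e))) (g (.ghost e))
  | ck1_same (e : Ed) : LeavittRel g (g (.ghost e) * g (.edge e)) (g (.vert (E.r e)))
  | ck1_ne (e f : Ed) (h : e ≠ f) : LeavittRel g (g (.ghost e) * g (.edge f)) 0
  | ck2 (x : V) (hfin : {e | E.s e = x}.Finite) (hne : {e | E.s e = x}.Nonempty) :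
      LeavittRel g (g (.vert x)) (∑ e ∈ hfin.toFinset, g (.edge e) * g (.ghost e))

lemma LeavittRel.map {A B : Type*} [NonUnitalSemiring A] [NonUnitalSemiring B] (φ : A →ₙ+* B)
    {g : Gen V Ed → A} {a b : A} (h : E.LeavittRel g a b) :
    E.LeavittRel (fun i => φ (g i)) (φ a) (φ b) := by
  cases h with
  | idem x => rw [map_mul]; exact .idem x
  | orth x y h => rw [map_mul, map_zero]; exact .orth x y h
  | source_edge e => rw [map_mul]; exact .source_edge e
  | edge_range e => rw [map_mul]; exact .edge_range e
  | range_ghost e => rw [map_mul]; exact .range_ghost e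
  | ghost_source e => rw [map_mul]; exact .ghost_source e
  | ck1_same e => rw [map_mul]; exact .ck1_same e
  | ck1_ne e f h => rw [map_mul, map_zero]; exact .ck1_ne e f h
  | ck2 x hfin hne => rw [map_sum]; simp only [map_mul]; exact .ck2 x hfin hne

/-- The free (associative, non-unital) `R`-algebra on the generators. -/
abbrev FreeGenAlgebra (R : Type w) [CommRing R] (V : Type u) (Ed : Type v) :
    Type (max u v w) := MonoidAlgebra R (FreeSemigroup (Gen V Ed))

/-- The generators inside the free algebra. -/
def freeGen (R : Type w) [CommRing R] (g : Gen V Ed) : FreeGenAlgebra R V Ed :=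
  MonoidAlgebra.single (FreeSemigroup.of g) 1

variable (E) (R : Type w) [CommRing R]

/-- The smallest `R`-linear ring congruence on the free algebra which contains the defining
relations. -/
def leavittCon : RingCon (FreeGenAlgebra R V Ed) :=
  ringConGen fun a b => ∃ (t : R) (x y : FreeGenAlgebra R V Ed),
    E.LeavittRel (freeGen R) x y ∧ a = t • x ∧ b = t • y

lemma leavittCon_smul (t : R) {a b : FreeGenAlgebra R V Ed} (h : E.leavittCon R a b) :
    E.leavittCon R (t • a) (t • b) := by
  change RingConGen.Rel _ a b at h
  induction h with
  | of a b h =>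
    obtain ⟨t', x, y, h, rfl, rfl⟩ := h
    exact RingConGen.Rel.of _ _ ⟨t * t', x, y, h, (mul_smul _ _ _).symm, (mul_smul _ _ _).symm⟩
  | refl a => exact (E.leavittCon R).refl _
  | symm _ ih => exact (E.leavittCon R).symm ih
  | trans _ _ ih₁ ih₂ => exact (E.leavittCon R).trans ih₁ ih₂
  | add _ _ ih₁ ih₂ => rw [smul_add, smul_add]; exact (E.leavittCon R).add ih₁ ih₂
  | mul _ h₂ ih₁ _ =>
    rw [← smul_mul_assoc, ← smul_mul_assoc]; exact (E.leavittCon R).mul ih₁ h₂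

/-- The Leavitt path algebra `L_R(E)`: the universal (not necessarily unital) `R`-algebra
generated by the vertices, edges and ghost edges subject to the defining relations. -/
def LeavittPathAlgebra : Type (max u v w) := (E.leavittCon R).Quotient

namespace LeavittPathAlgebra

instance : NonUnitalRing (E.LeavittPathAlgebra R) :=
  inferInstanceAs (NonUnitalRing (E.leavittCon R).Quotient)

/-- The quotient map from the free algebra. -/
def mk : FreeGenAlgebra R V Ed → E.LeavittPathAlgebra R := fun a => (a : (E.leavittCon R).Quotient)

variable {E R}

lemma mk_surjective : Function.Surjective (mk E R) := Quotient.mk''_surjective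

lemma mk_add (a b : FreeGenAlgebra R V Ed) : mk E R (a + b) = mk E R a + mk E R b := rfl

lemma mk_mul (a b : FreeGenAlgebra R V Ed) : mk E R (a * b) = mk E R a * mk E R b := rfl

lemma mk_zero : mk E R 0 = 0 := rfl

instance : SMul R (E.LeavittPathAlgebra R) where
  smul t := Quotient.map' (fun a => t • a) fun _ _ h => leavittCon_smul E R t h

lemma mk_smul (t : R) (a : FreeGenAlgebra R V Ed) : mk E R (t • a) = t • mk E R a := rfl

instance : Module R (E.LeavittPathAlgebra R) where
  one_smul x := by
    obtain ⟨a, rfl⟩ := mk_surjective x; rw [← mk_smul, one_smul]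
  mul_smul t t' x := by
    obtain ⟨a, rfl⟩ := mk_surjective x; simp only [← mk_smul, mul_smul]
  smul_zero t := by rw [← mk_zero, ← mk_smul, smul_zero]
  smul_add t x y := by
    obtain ⟨a, rfl⟩ := mk_surjective x
    obtain ⟨b, rfl⟩ := mk_surjective y
    simp only [← mk_smul, ← mk_add, smul_add]
  add_smul t t' x := by
    obtain ⟨a, rfl⟩ := mk_surjective x
    simp only [← mk_smul, ← mk_add, add_smul]
  zero_smul x := by
    obtain ⟨a, rfl⟩ := mk_surjective x; rw [← mk_smul, zero_smul, mk_zero]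

instance : IsScalarTower R (E.LeavittPathAlgebra R) (E.LeavittPathAlgebra R) where
  smul_assoc t x y := by
    obtain ⟨a, rfl⟩ := mk_surjective x
    obtain ⟨b, rfl⟩ := mk_surjective y
    simp only [smul_eq_mul, ← mk_smul, ← mk_mul, smul_mul_assoc]

instance : SMulCommClass R (E.LeavittPathAlgebra R) (E.LeavittPathAlgebra R) where
  smul_comm t x y := by
    obtain ⟨a, rfl⟩ := mk_surjective x
    obtain ⟨b, rfl⟩ := mk_surjective y
    simp only [smul_eq_mul, ← mk_smul, ← mk_mul, mul_smul_comm]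

/-- The quotient map as a homomorphism of non-unital algebras. -/
def mkHom : FreeGenAlgebra R V Ed →ₙₐ[R] E.LeavittPathAlgebra R where
  toFun := mk E R
  map_smul' _ _ := rfl
  map_zero' := rfl
  map_add' _ _ := rfl
  map_mul' _ _ := rfl

variable (E R) in
/-- The generators of `L_R(E)`. -/
def gen (g : Gen V Ed) : E.LeavittPathAlgebra R := mk E R (freeGen R g)

lemma gen_rel {a b : E.LeavittPathAlgebra R} (h : E.LeavittRel (gen E R) a b) : a = b := by
  have key : ∀ x y, E.LeavittRel (freeGen R) x y → mk E R x = mk E R y := fun x y hxy =>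
    Quotient.sound' (RingConGen.Rel.of x y
      ⟨1, x, y, hxy, (one_smul R x).symm, (one_smul R y).symm⟩)
  have hsum : ∀ (s : Finset Ed) (f : Ed → FreeGenAlgebra R V Ed),
      mk E R (∑ e ∈ s, f e) = ∑ e ∈ s, mk E R (f e) := fun s f =>
    map_sum (mkHom (E := E) (R := R)) f s
  cases h with
  | idem x => exact key _ _ (.idem x)
  | orth x y h => exact key _ _ (.orth x y h)
  | source_edge e => exact key _ _ (.source_edge e)
  | edge_range e => exact key _ _ (.edge_range e)
  | range_ghost e => exact key _ _ (.range_ghost e)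
  | ghost_source e => exact key _ _ (.ghost_source e)
  | ck1_same e => exact key _ _ (.ck1_same e)
  | ck1_ne e f h => exact key _ _ (.ck1_ne e f h)
  | ck2 x hfin hne => exact (key _ _ (.ck2 x hfin hne)).trans (hsum _ _)

section lift

variable {A : Type*} [NonUnitalSemiring A] [Module R A] [IsScalarTower R A A] [SMulCommClass R A A]

/-- The homomorphism from the free algebra determined by the images of the generators. -/
def freeLift (g : Gen V Ed → A) : FreeGenAlgebra R V Ed →ₙₐ[R] A :=
  MonoidAlgebra.liftMagma R (FreeSemigroup.lift g)

lemma freeLift_freeGen (g : Gen V Ed → A) (i : Gen V Ed) :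
    freeLift (R := R) g (freeGen R i) = g i := by
  simp [freeLift, freeGen]

lemma freeLift_rel (g : Gen V Ed → A) (hg : ∀ a b, E.LeavittRel g a b → a = b)
    {x y : FreeGenAlgebra R V Ed} (h : E.leavittCon R x y) :
    freeLift (R := R) g x = freeLift (R := R) g y := by
  change RingConGen.Rel _ x y at h
  induction h with
  | of a b h =>
    obtain ⟨t, x, y, h, rfl, rfl⟩ := h
    have h' := h.map ((freeLift (R := R) g : FreeGenAlgebra R V Ed →ₙₐ[R] A) :
      FreeGenAlgebra R V Ed →ₙ+* A)
    have e1 : (fun i => ((freeLift (R := R) g : FreeGenAlgebra R V Ed →ₙₐ[R] A) :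
      FreeGenAlgebra R V Ed →ₙ+* A) (freeGen R i)) = g := funext (freeLift_freeGen g)
    rw [e1] at h'
    rw [map_smul, map_smul]
    exact congrArg _ (hg _ _ h')
  | refl a => rfl
  | symm _ ih => exact ih.symm
  | trans _ _ ih₁ ih₂ => exact ih₁.trans ih₂
  | add _ _ ih₁ ih₂ => rw [map_add, map_add, ih₁, ih₂]
  | mul _ _ ih₁ ih₂ => rw [map_mul, map_mul, ih₁, ih₂]

/-- The universal property of `L_R(E)`: a family satisfying the defining relations in an
`R`-algebra `A` induces a homomorphism from `L_R(E)` to `A`. -/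
def lift (g : Gen V Ed → A) (hg : ∀ a b, E.LeavittRel g a b → a = b) :
    E.LeavittPathAlgebra R →ₙₐ[R] A where
  toFun := Quotient.lift (fun a => freeLift (R := R) g a) fun _ _ h => freeLift_rel g hg h
  map_smul' t x := by obtain ⟨a, rfl⟩ := mk_surjective x; exact map_smul (freeLift (R := R) g) t a
  map_zero' := map_zero (freeLift (R := R) g)
  map_add' x y := by
    obtain ⟨a, rfl⟩ := mk_surjective x
    obtain ⟨b, rfl⟩ := mk_surjective y
    exact map_add (freeLift (R := R) g) a b
  map_mul' x y := by
    obtain ⟨a, rfl⟩ := mk_surjective x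
    obtain ⟨b, rfl⟩ := mk_surjective y
    exact map_mul (freeLift (R := R) g) a b

lemma lift_gen (g : Gen V Ed → A) (hg : ∀ a b, E.LeavittRel g a b → a = b) (i : Gen V Ed) :
    lift (R := R) g hg (gen E R i) = g i := freeLift_freeGen g i

end lift

lemma hom_ext {A : Type*} [NonUnitalSemiring A] [Module R A]
    {φ ψ : E.LeavittPathAlgebra R →ₙₐ[R] A} (h : ∀ i, φ (gen E R i) = ψ (gen E R i)) :
    φ = ψ := by
  have : φ.comp mkHom = ψ.comp mkHom := by
    apply MonoidAlgebra.nonUnitalAlgHom_ext'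
    apply FreeSemigroup.hom_ext
    funext i
    exact h i
  ext x
  obtain ⟨a, rfl⟩ := mk_surjective x
  exact DFunLike.congr_fun this a

/-- The images of the generators under the involution. -/
def starGen : Gen V Ed → E.LeavittPathAlgebra R
  | .vert x => gen E R (.vert x)
  | .edge e => gen E R (.ghost e)
  | .ghost e => gen E R (.edge e)

lemma starGen_rel (a b : (E.LeavittPathAlgebra R)ᵐᵒᵖ)
    (h : E.LeavittRel (fun i => MulOpposite.op (starGen (E := E) (R := R) i)) a b) : a = b := by
  cases h with
  | idem x => exact congrArg MulOpposite.op (gen_rel (.idem x))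
  | orth x y h => exact congrArg MulOpposite.op (gen_rel (.orth y x h.symm))
  | source_edge e => exact congrArg MulOpposite.op (gen_rel (.ghost_source e))
  | edge_range e => exact congrArg MulOpposite.op (gen_rel (.range_ghost e))
  | range_ghost e => exact congrArg MulOpposite.op (gen_rel (.edge_range e))
  | ghost_source e => exact congrArg MulOpposite.op (gen_rel (.source_edge e))
  | ck1_same e => exact congrArg MulOpposite.op (gen_rel (.ck1_same e))
  | ck1_ne e f h => exact congrArg MulOpposite.op (gen_rel (.ck1_ne f e h.symm))
  | ck2 x hfin hne =>
    refine (congrArg MulOpposite.op (gen_rel (.ck2 x hfin hne))).trans ?_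
    exact map_sum (MulOpposite.opAddEquiv (α := E.LeavittPathAlgebra R)) _ _

instance : IsScalarTower R (E.LeavittPathAlgebra R)ᵐᵒᵖ (E.LeavittPathAlgebra R)ᵐᵒᵖ where
  smul_assoc t x y := MulOpposite.unop_injective (mul_smul_comm t y.unop x.unop)

instance : SMulCommClass R (E.LeavittPathAlgebra R)ᵐᵒᵖ (E.LeavittPathAlgebra R)ᵐᵒᵖ where
  smul_comm t x y := MulOpposite.unop_injective (smul_mul_assoc t y.unop x.unop).symm

/-- The involution as a homomorphism to the opposite algebra. -/
def starHom : E.LeavittPathAlgebra R →ₙₐ[R] (E.LeavittPathAlgebra R)ᵐᵒᵖ :=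
  lift (fun i => MulOpposite.op (starGen i)) starGen_rel

/-- The `R`-linear involution of `L_R(E)`: it is the anti-automorphism which fixes the vertices and
exchanges `e` and `e*`. -/
instance : StarRing (E.LeavittPathAlgebra R) where
  star x := (starHom x).unop
  star_involutive := by
    let ψ : E.LeavittPathAlgebra R →ₙₐ[R] E.LeavittPathAlgebra R :=
      { toFun := fun x => (starHom (starHom x).unop).unop
        map_smul' := fun t x => by simp
        map_zero' := by simp
        map_add' := fun x y => by simp
        map_mul' := fun x y => by simp }
    have hg : ∀ i, starHom (gen E R i) = MulOpposite.op (starGen i) := lift_gen _ starGen_rel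
    have : ψ = NonUnitalAlgHom.id R (E.LeavittPathAlgebra R) := by
      apply hom_ext
      intro i
      change (starHom (starHom (gen E R i)).unop).unop = gen E R i
      rw [hg]
      cases i <;> simp [starGen, hg]
    exact fun x => DFunLike.congr_fun this x
  star_mul x y := by simp
  star_add x y := by simp

lemma star_gen (i : Gen V Ed) : star (gen E R i) = starGen i :=
  congrArg MulOpposite.unop (lift_gen _ starGen_rel i)

lemma star_smul' (t : R) (x : E.LeavittPathAlgebra R) : star (t • x) = t • star x :=
  congrArg MulOpposite.unop (map_smul starHom t x)

variable (E R)

/-- The element `e₁ ⋯ eₙ` (for `n ≥ 1`), or `x` (for `n = 0`); note that `eₙ r(eₙ) = eₙ`. -/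
def walkElem : V → List Ed → E.LeavittPathAlgebra R
  | x, [] => gen E R (.vert x)
  | _, e :: l => gen E R (.edge e) * walkElem (E.r e) l

/-- The element of `L_R(E)` given by a path. -/
def pathElem (α : E.Path) : E.LeavittPathAlgebra R := walkElem E R α.source α.edges

/-- The standard generating set `G_E = {α β* : r(α) = r(β)}`. -/
def standardGens : Set (E.LeavittPathAlgebra R) :=
  {x | ∃ α β : E.Path, α.range = β.range ∧ x = pathElem E R α * star (pathElem E R β)}

/-- The set `G_E^M` of the normal elements of `G_E`. -/
def normalGens : Set (E.LeavittPathAlgebra R) := {x ∈ standardGens E R | x * star x = star x * x}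

/-- The commutative core `M_R(E)`: the subalgebra generated by the normal generators. -/
def commutativeCore : NonUnitalSubalgebra R (E.LeavittPathAlgebra R) :=
  NonUnitalAlgebra.adjoin R (normalGens E R)

end LeavittPathAlgebra

end DirectedGraph

/-! ### Conditional expectations -/

/-- The positive elements of a subalgebra with underlying set `B`: the finite sums of elements
`y* y` with `y ∈ B`. -/
def positiveElements {A : Type*} [NonUnitalRing A] [StarRing A] (B : Set A) : Set A :=
  (AddSubmonoid.closure {z : A | ∃ y ∈ B, z = star y * y} : Set A)

/-- `F` is a conditional expectation of the algebra with involution `A` onto its subalgebra with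
involution `B`. -/
structure IsConditionalExpectation {R A : Type*} [CommRing R] [NonUnitalRing A] [StarRing A]
    [Module R A] (B : NonUnitalSubalgebra R A) (F : A →ₗ[R] B) : Prop where
  star_mem : ∀ b ∈ B, star b ∈ B
  positive : ∀ a : A, a ∈ positiveElements Set.univ → (F a : A) ∈ positiveElements (B : Set A)
  idempotent : ∀ a : A, F (F a : A) = F a
  surjective : Function.Surjective F
  map_mul : ∀ (b : B) (a : A), F ((b : A) * a) = b * F a

namespace DirectedGraph

/-! ### The essentially aperiodic representation -/

section representation

variable {V : Type u} {Ed : Type v} (E : DirectedGraph V Ed) (R : Type w) [CommRing R]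

/-- The free `R`-module `M` with basis `ξ_τ^n`, for `τ` an essentially aperiodic trail and `n` an
integer. -/
abbrev TrailModule : Type (max u v w) := (E.EssTrail × ℤ) →₀ R

variable {E} in
/-- The basis element `ξ_τ^n`. -/
def xi (τ : E.EssTrail) (n : ℤ) : E.TrailModule R := Finsupp.single (τ, n) 1

/-- The homogeneous component `M_i`. -/
def trailDegree (i : ℤ) : Submodule R (E.TrailModule R) :=
  Submodule.span R (Set.range fun τ : E.EssTrail => xi R τ i)

/-- The endomorphisms of `M` which are homogeneous of degree `i`. -/
def endDegree (i : ℤ) : Submodule R (Module.End R (E.TrailModule R)) where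
  carrier := {f | ∀ j, ∀ m ∈ E.trailDegree R j, f m ∈ E.trailDegree R (j + i)}
  add_mem' hf hg j m hm := Submodule.add_mem _ (hf j m hm) (hg j m hm)
  zero_mem' _ _ _ := Submodule.zero_mem _
  smul_mem' t _ hf j m hm := Submodule.smul_mem _ t (hf j m hm)

lemma endDegree_mul {i j : ℤ} {f g : Module.End R (E.TrailModule R)} (hf : f ∈ E.endDegree R i)
    (hg : g ∈ E.endDegree R j) : f * g ∈ E.endDegree R (i + j) := by
  intro k m hm
  have := hf _ _ (hg k m hm)
  rwa [add_assoc, add_comm j i] at this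

/-- The graded algebra `𝓔`: the sum of the spaces of homogeneous endomorphisms of `M`. -/
def gradedEnd : Subalgebra R (Module.End R (E.TrailModule R)) :=
  (⨆ i, E.endDegree R i).toSubalgebra
    (Submodule.mem_iSup_of_mem 0 fun j m hm => by rw [add_zero]; exact hm)
    (by
      intro f g hf hg
      induction hf using Submodule.iSup_induction' with
      | mem i f hf =>
        induction hg using Submodule.iSup_induction' with
        | mem j g hg => exact Submodule.mem_iSup_of_mem _ (E.endDegree_mul R hf hg)
        | zero => rw [mul_zero]; exact Submodule.zero_mem _
        | add g g' _ _ h h' => rw [mul_add]; exact Submodule.add_mem _ h h'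
      | zero => rw [zero_mul]; exact Submodule.zero_mem _
      | add f f' _ _ h h' => rw [add_mul]; exact Submodule.add_mem _ h h')

lemma mem_gradedEnd_of_mem {i : ℤ} {f : Module.End R (E.TrailModule R)}
    (hf : f ∈ E.endDegree R i) : f ∈ E.gradedEnd R :=
  Submodule.mem_iSup_of_mem (p := fun i => E.endDegree R i) i hf

/-- The endomorphism of `M` with prescribed values on the basis elements `ξ_τ^n`. -/
def basisEnd (φ : E.EssTrail → ℤ → E.TrailModule R) : Module.End R (E.TrailModule R) :=
  Finsupp.linearCombination R fun p : E.EssTrail × ℤ => φ p.1 p.2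

variable {E R}

lemma basisEnd_xi (φ : E.EssTrail → ℤ → E.TrailModule R) (τ : E.EssTrail) (n : ℤ) :
    E.basisEnd R φ (xi R τ n) = φ τ n := by
  simp [basisEnd, xi]

lemma end_ext {f g : Module.End R (E.TrailModule R)}
    (h : ∀ τ n, f (xi R τ n) = g (xi R τ n)) : f = g := by
  apply Finsupp.lhom_ext'
  rintro ⟨τ, n⟩
  apply LinearMap.ext_ring
  exact h τ n

lemma xi_mem (τ : E.EssTrail) (n : ℤ) : xi R τ n ∈ E.trailDegree R n :=
  Submodule.subset_span ⟨τ, rfl⟩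

lemma mem_endDegree {i : ℤ} {f : Module.End R (E.TrailModule R)}
    (h : ∀ τ n, f (xi R τ n) ∈ E.trailDegree R (n + i)) : f ∈ E.endDegree R i := by
  intro j m hm
  induction hm using Submodule.span_induction with
  | mem x hx => obtain ⟨τ, rfl⟩ := hx; exact h τ j
  | zero => rw [map_zero]; exact Submodule.zero_mem _
  | add x y _ _ hx hy => rw [map_add]; exact Submodule.add_mem _ hx hy
  | smul t x _ hx => rw [map_smul]; exact Submodule.smul_mem _ t hx

variable (E R)

open Classical in
/-- `S_x` for a vertex `x`: `ξ_τ^n ↦ ξ_τ^n` if `s(τ) = x`, and `0` otherwise. -/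
def vertOp (x : V) : Module.End R (E.TrailModule R) :=
  E.basisEnd R fun τ n => if τ.source = x then xi R τ n else 0

open Classical in
/-- `S_e` for an edge `e`: `ξ_τ^n ↦ ξ_{eτ}^{n+1}` if `r(e) = s(τ)`, and `0` otherwise. -/
def edgeOp (e : Ed) : Module.End R (E.TrailModule R) :=
  E.basisEnd R fun τ n => if h : E.r e = τ.source then xi R (τ.cons e h) (n + 1) else 0

open Classical in
/-- `S_e*` for an edge `e`: `ξ_τ^n ↦ ξ_β^{n-1}` if `τ = e β`, and `0` otherwise. -/
def ghostOp (e : Ed) : Module.End R (E.TrailModule R) :=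
  E.basisEnd R fun τ n =>
    if h : ∃ (β : E.EssTrail) (hβ : E.r e = β.source), τ = β.cons e hβ
    then xi R h.choose (n - 1) else 0

/-- The operators on `M` attached to the generators of `L_R(E)`. -/
def genOp : Gen V Ed → Module.End R (E.TrailModule R)
  | .vert x => E.vertOp R x
  | .edge e => E.edgeOp R e
  | .ghost e => E.ghostOp R e

variable {E R}

lemma vertOp_xi_same (τ : E.EssTrail) (n : ℤ) : E.vertOp R τ.source (xi R τ n) = xi R τ n := by
  rw [vertOp, basisEnd_xi, if_pos rfl]

lemma vertOp_xi_ne {x : V} {τ : E.EssTrail} (h : τ.source ≠ x) (n : ℤ) :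
    E.vertOp R x (xi R τ n) = 0 := by
  rw [vertOp, basisEnd_xi, if_neg h]

lemma edgeOp_xi {e : Ed} {τ : E.EssTrail} (h : E.r e = τ.source) (n : ℤ) :
    E.edgeOp R e (xi R τ n) = xi R (τ.cons e h) (n + 1) := by
  rw [edgeOp, basisEnd_xi, dif_pos h]

lemma edgeOp_xi_ne {e : Ed} {τ : E.EssTrail} (h : E.r e ≠ τ.source) (n : ℤ) :
    E.edgeOp R e (xi R τ n) = 0 := by
  rw [edgeOp, basisEnd_xi, dif_neg h]

lemma ghostOp_xi_cons {e : Ed} {β : E.EssTrail} (h : E.r e = β.source) (n : ℤ) :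
    E.ghostOp R e (xi R (β.cons e h) n) = xi R β (n - 1) := by
  have hex : ∃ (β' : E.EssTrail) (hβ : E.r e = β'.source), β.cons e h = β'.cons e hβ := ⟨β, h, rfl⟩
  rw [ghostOp, basisEnd_xi, dif_pos hex]
  obtain ⟨h1, h2⟩ := hex.choose_spec
  rw [← (EssTrail.cons_inj h h1 h2).2]

lemma ghostOp_xi_ne {e : Ed} {τ : E.EssTrail}
    (h : ¬ ∃ (β : E.EssTrail) (hβ : E.r e = β.source), τ = β.cons e hβ) (n : ℤ) :
    E.ghostOp R e (xi R τ n) = 0 := by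
  rw [ghostOp, basisEnd_xi, dif_neg h]

lemma ghostOp_xi_cons_ne {e e' : Ed} (hne : e ≠ e') {β : E.EssTrail} (h : E.r e' = β.source)
    (n : ℤ) : E.ghostOp R e (xi R (β.cons e' h) n) = 0 :=
  ghostOp_xi_ne (fun ⟨_, h', H⟩ => hne (EssTrail.cons_inj h h' H).1.symm) n

lemma genOp_mem (i : Gen V Ed) : E.genOp R i ∈ E.gradedEnd R := by
  cases i with
  | vert x =>
    refine E.mem_gradedEnd_of_mem R (i := 0) (mem_endDegree fun τ n => ?_)
    by_cases h : τ.source = x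
    · subst h
      rw [genOp, vertOp_xi_same, add_zero]; exact xi_mem τ n
    · rw [genOp, vertOp_xi_ne h]; exact Submodule.zero_mem _
  | edge e =>
    refine E.mem_gradedEnd_of_mem R (i := 1) (mem_endDegree fun τ n => ?_)
    by_cases h : E.r e = τ.source
    · rw [genOp, edgeOp_xi h]; exact xi_mem _ _
    · rw [genOp, edgeOp_xi_ne h]; exact Submodule.zero_mem _
  | ghost e =>
    refine E.mem_gradedEnd_of_mem R (i := -1) (mem_endDegree fun τ n => ?_)
    by_cases h : ∃ (β : E.EssTrail) (hβ : E.r e = β.source), τ = β.cons e hβ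
    · obtain ⟨β, hβ, rfl⟩ := h
      rw [genOp, ghostOp_xi_cons]; exact xi_mem _ _
    · rw [genOp, ghostOp_xi_ne h]; exact Submodule.zero_mem _

/-- The operators attached to the generators satisfy the defining relations of `L_R(E)`. -/
lemma genOp_rel (a b : Module.End R (E.TrailModule R)) (h : E.LeavittRel (E.genOp R) a b) :
    a = b := by
  cases h with
  | idem x =>
    refine end_ext fun τ n => ?_
    simp only [genOp, Module.End.mul_apply]
    by_cases h : τ.source = x
    · subst h; rw [vertOp_xi_same, vertOp_xi_same]
    · rw [vertOp_xi_ne h, map_zero]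
  | orth x y hxy =>
    refine end_ext fun τ n => ?_
    simp only [genOp, Module.End.mul_apply, LinearMap.zero_apply]
    by_cases h : τ.source = y
    · subst h; rw [vertOp_xi_same, vertOp_xi_ne hxy.symm]
    · rw [vertOp_xi_ne h, map_zero]
  | source_edge e =>
    refine end_ext fun τ n => ?_
    simp only [genOp, Module.End.mul_apply]
    by_cases h : E.r e = τ.source
    · rw [edgeOp_xi h, ← EssTrail.source_cons e τ h, vertOp_xi_same]
    · rw [edgeOp_xi_ne h, map_zero]
  | edge_range e =>
    refine end_ext fun τ n => ?_
    simp only [genOp, Module.End.mul_apply]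
    by_cases h : E.r e = τ.source
    · rw [h, vertOp_xi_same]
    · rw [vertOp_xi_ne (Ne.symm h), edgeOp_xi_ne h, map_zero]
  | range_ghost e =>
    refine end_ext fun τ n => ?_
    simp only [genOp, Module.End.mul_apply]
    by_cases h : ∃ (β : E.EssTrail) (hβ : E.r e = β.source), τ = β.cons e hβ
    · obtain ⟨β, hβ, rfl⟩ := h
      rw [ghostOp_xi_cons, hβ, vertOp_xi_same]
    · rw [ghostOp_xi_ne h, map_zero]
  | ghost_source e =>
    refine end_ext fun τ n => ?_
    simp only [genOp, Module.End.mul_apply]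
    by_cases h : ∃ (β : E.EssTrail) (hβ : E.r e = β.source), τ = β.cons e hβ
    · obtain ⟨β, hβ, rfl⟩ := h
      rw [← EssTrail.source_cons e β hβ, vertOp_xi_same]
    · rw [ghostOp_xi_ne h]
      by_cases h' : τ.source = E.s e
      · rw [← h', vertOp_xi_same, ghostOp_xi_ne h]
      · rw [vertOp_xi_ne h', map_zero]
  | ck1_same e =>
    refine end_ext fun τ n => ?_
    simp only [genOp, Module.End.mul_apply]
    by_cases h : E.r e = τ.source
    · rw [edgeOp_xi h, ghostOp_xi_cons, h, vertOp_xi_same, add_sub_cancel_right]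
    · rw [edgeOp_xi_ne h, vertOp_xi_ne (Ne.symm h), map_zero]
  | ck1_ne e f hef =>
    refine end_ext fun τ n => ?_
    simp only [genOp, Module.End.mul_apply, LinearMap.zero_apply]
    by_cases h : E.r f = τ.source
    · rw [edgeOp_xi h, ghostOp_xi_cons_ne hef]
    · rw [edgeOp_xi_ne h, map_zero]
  | ck2 x hfin hne =>
    refine end_ext fun τ n => ?_
    simp only [genOp, LinearMap.sum_apply, Module.End.mul_apply]
    by_cases h : τ.source = x
    · subst h
      obtain ⟨e, β, hβ, rfl⟩ := τ.exists_cons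
        (fun hs => by obtain ⟨e, he⟩ := hne; exact hs e he)
      rw [vertOp_xi_same, Finset.sum_eq_single e]
      · rw [ghostOp_xi_cons, edgeOp_xi hβ, sub_add_cancel]
      · intro f _ hf
        rw [ghostOp_xi_cons_ne hf, map_zero]
      · intro he
        exact absurd ((Set.Finite.mem_toFinset hfin).2 (EssTrail.source_cons e β hβ).symm) he
    · rw [vertOp_xi_ne h]
      refine (Finset.sum_eq_zero fun e he => ?_).symm
      rw [ghostOp_xi_ne, map_zero]
      rintro ⟨β, hβ, rfl⟩
      rw [EssTrail.source_cons] at h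
      exact h ((Set.Finite.mem_toFinset hfin).1 he)

lemma genOp_rel' (a b : E.gradedEnd R)
    (h : E.LeavittRel (fun i => (⟨E.genOp R i, genOp_mem i⟩ : E.gradedEnd R)) a b) : a = b :=
  Subtype.ext (genOp_rel _ _
    (h.map ((E.gradedEnd R).val : E.gradedEnd R →ₙ+* Module.End R (E.TrailModule R))))

variable (E R)

/-- The essentially aperiodic representation `Π_ap : L_R(E) → 𝓔`. -/
def aperiodicRep : E.LeavittPathAlgebra R →ₙₐ[R] E.gradedEnd R :=
  LeavittPathAlgebra.lift (fun i => (⟨E.genOp R i, genOp_mem i⟩ : E.gradedEnd R)) genOp_rel'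

open Classical in
/-- The projection `Q_τ`: `ξ_τ'^n ↦ ξ_τ^n` if `τ' = τ`, and `0` otherwise. -/
def trailProj (τ : E.EssTrail) : Module.End R (E.TrailModule R) :=
  E.basisEnd R fun τ' n => if τ' = τ then xi R τ n else 0

variable {E R}

lemma trailProj_xi_same (τ : E.EssTrail) (n : ℤ) : E.trailProj R τ (xi R τ n) = xi R τ n := by
  rw [trailProj, basisEnd_xi, if_pos rfl]

lemma trailProj_xi_ne {τ τ' : E.EssTrail} (h : τ' ≠ τ) (n : ℤ) :
    E.trailProj R τ (xi R τ' n) = 0 := by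
  rw [trailProj, basisEnd_xi, if_neg h]

lemma trailProj_mem (τ : E.EssTrail) : E.trailProj R τ ∈ E.endDegree R 0 := by
  refine mem_endDegree fun τ' n => ?_
  by_cases h : τ' = τ
  · subst h; rw [trailProj_xi_same, add_zero]; exact xi_mem _ _
  · rw [trailProj_xi_ne h]; exact Submodule.zero_mem _

/-- For every `m ∈ M` there are finitely many trails `τ₁, …, τₙ` with `(∑ Q_{τᵢ}) m = m`. -/
lemma exists_sum_trailProj (m : E.TrailModule R) :
    ∃ s : Finset E.EssTrail, (∑ τ ∈ s, E.trailProj R τ) m = m := by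
  classical
  refine ⟨m.support.image Prod.fst, ?_⟩
  have key : ∀ p ∈ m.support, (∑ τ ∈ m.support.image Prod.fst, E.trailProj R τ)
      (Finsupp.single p (m p)) = Finsupp.single p (m p) := by
    rintro ⟨τ, n⟩ hp
    have h1 : Finsupp.single (τ, n) (m (τ, n)) = m (τ, n) • xi R τ n := by simp [xi]
    rw [h1, map_smul, LinearMap.sum_apply, Finset.sum_eq_single τ, trailProj_xi_same]
    · exact fun τ' _ h => trailProj_xi_ne (Ne.symm h) n
    · exact fun h => absurd (Finset.mem_image.2 ⟨_, hp, rfl⟩) h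
  have h2 : m = ∑ p ∈ m.support, Finsupp.single p (m p) := m.sum_single.symm
  calc (∑ τ ∈ m.support.image Prod.fst, E.trailProj R τ) m
      = (∑ τ ∈ m.support.image Prod.fst, E.trailProj R τ)
          (∑ p ∈ m.support, Finsupp.single p (m p)) := congrArg _ h2
    _ = ∑ p ∈ m.support, Finsupp.single p (m p) := by
      rw [map_sum, Finset.sum_congr rfl key]
    _ = m := h2.symm

variable (E R)

/-- The linear map `T ↦ (m ↦ (∑ Q_{τᵢ} T Q_{τᵢ}) m)` on `End(M)`, where `(∑ Q_{τᵢ}) m = m`; see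
`aperiodicExpEnd_apply`. -/
def aperiodicExpEnd : Module.End R (E.TrailModule R) →ₗ[R] Module.End R (E.TrailModule R) where
  toFun T := E.basisEnd R fun τ n => E.trailProj R τ (T (xi R τ n))
  map_add' T T' := end_ext fun τ n => by simp [basisEnd_xi]
  map_smul' t T := end_ext fun τ n => by simp [basisEnd_xi]

variable {E R}

lemma aperiodicExpEnd_xi (T : Module.End R (E.TrailModule R)) (τ : E.EssTrail) (n : ℤ) :
    E.aperiodicExpEnd R T (xi R τ n) = E.trailProj R τ (T (xi R τ n)) :=
  basisEnd_xi (fun τ n => E.trailProj R τ (T (xi R τ n))) τ n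

/-- `E_ap(T) m = (∑ Q_{τᵢ} T Q_{τᵢ}) m` for all trails `τ₁, …, τₙ` such that `(∑ Q_{τᵢ}) m = m`. -/
lemma aperiodicExpEnd_apply (T : Module.End R (E.TrailModule R)) (m : E.TrailModule R)
    (s : Finset E.EssTrail) (hs : (∑ τ ∈ s, E.trailProj R τ) m = m) :
    E.aperiodicExpEnd R T m = (∑ τ ∈ s, E.trailProj R τ * T * E.trailProj R τ) m := by
  have key : ∀ τ, E.aperiodicExpEnd R T * E.trailProj R τ =
      E.trailProj R τ * T * E.trailProj R τ := by
    intro τ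
    refine end_ext fun τ' n => ?_
    simp only [Module.End.mul_apply]
    by_cases h : τ' = τ
    · subst h; rw [trailProj_xi_same, aperiodicExpEnd_xi]
    · rw [trailProj_xi_ne h, map_zero, map_zero, map_zero]
  conv_lhs => rw [← hs]
  rw [← Module.End.mul_apply, Finset.mul_sum, Finset.sum_congr rfl fun τ _ => key τ]

lemma aperiodicExpEnd_mem (T : Module.End R (E.TrailModule R)) (hT : T ∈ E.gradedEnd R) :
    E.aperiodicExpEnd R T ∈ E.gradedEnd R := by
  change T ∈ ⨆ i, E.endDegree R i at hT
  induction hT using Submodule.iSup_induction' with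
  | mem i f hf =>
    refine E.mem_gradedEnd_of_mem R (i := i) (mem_endDegree fun τ n => ?_)
    have h1 := trailProj_mem τ _ _ (hf n _ (xi_mem τ n))
    rw [add_zero] at h1
    rw [aperiodicExpEnd_xi]; exact h1
  | zero => rw [map_zero]; exact Subalgebra.zero_mem _
  | add f g _ _ hf hg => rw [map_add]; exact Subalgebra.add_mem _ hf hg

variable (E R)

/-- The aperiodic conditional expectation `E_ap : 𝓔 → 𝓔`. -/
def aperiodicExp : E.gradedEnd R →ₗ[R] E.gradedEnd R :=
  (E.aperiodicExpEnd R).restrict (p := Subalgebra.toSubmodule (E.gradedEnd R))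
    (q := Subalgebra.toSubmodule (E.gradedEnd R)) aperiodicExpEnd_mem

end representation

end DirectedGraph

end

namespace DirectedGraph

variable {V : Type u} {Ed : Type v} {E : DirectedGraph V Ed}

/-! ### Walks -/

/-! The monomials `α β*` span `L_R(E)`, and the only linear relations that a map defined on pairs of
paths has to respect are `α β* = ∑ αe (βe)*`, the sum being over the edges leaving `r(α)` when these
are finitely many and at least one. `exists_linearMap` proves this without a basis, by letting the
algebra act by right translation on the functions on pairs that respect these relations.

For `x = α β*` one has `x x* = α α*` and `x* x = β β*`. Since vertices are nonzero over a nontrivial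
ring, these projections agree exactly when `α = β`, or one path extends the other beyond a vertex
from which no branching can be reached (`mem_normalGens_iff`). This condition, `IsNormalPair`, is an
equivalence relation on paths, and `(αt, βt)` satisfies it if and only if `(α, β)` does. With `t` an
edge, this makes the rule "keep normal pairs, kill the others" respect the relations, so it defines
`F`; with `t` arbitrary, it gives `F(ba) = b F(a)` for `b` in the core (`map_monomial_mul`).

Positivity is the hard point, as `R` carries no order. Regard `F(a* b)` as an inner product with
values in the core and run Gram–Schmidt on finitely many elements of `G_E`. Each new `g` is replaced
by `n = g - P g`, where `P` is the orthogonal projection built so far. This works because `P g = g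
f` for a projection `f ≤ g* g` in the core that commutes with the core; then `n* n` is again a
projection and no division is needed. For `y` in the span of the chosen elements, `F(y* y) = F(y* P
y)` is the sum of the terms `F(n* y)* F(n* y)` (`IsFrameProjection.exists_extension`).

In the aperiodic representation, `α β*` sends the basis vectors of `βτ` to those of `ατ`, up to a
shift of degree. If the pair is normal then `ατ = βτ`, because only one trail starts at a vertex
that leads to no branching. Conversely `ατ = βτ` with `α ≠ β` gives `τ = cτ` with `c` nonempty, and
essential aperiodicity then excludes branching. So compressing to the trail projections keeps normal
monomials and kills all others, exactly as `F` does. -/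

lemma endFrom_append (x : V) (l m : List Ed) :
    E.endFrom x (l ++ m) = E.endFrom (E.endFrom x l) m := by
  induction l generalizing x with
  | nil => rfl
  | cons e l ih => exact ih _

lemma isWalkFrom_append {x : V} {l m : List Ed} :
    E.IsWalkFrom x (l ++ m) ↔ E.IsWalkFrom x l ∧ E.IsWalkFrom (E.endFrom x l) m := by
  induction l generalizing x with
  | nil => simp [IsWalkFrom, endFrom]
  | cons e l ih => simp [IsWalkFrom, endFrom, ih, and_assoc]

lemma isWalkFrom_singleton {x : V} {e : Ed} : E.IsWalkFrom x [e] ↔ E.s e = x := by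
  simp [IsWalkFrom]

lemma isWalkFrom_concat {x : V} {l : List Ed} {e : Ed} :
    E.IsWalkFrom x (l ++ [e]) ↔ E.IsWalkFrom x l ∧ E.s e = E.endFrom x l := by
  rw [isWalkFrom_append, isWalkFrom_singleton]

variable (E) in
/-- Any two walks starting at `x` are comparable: `x` does not lead to a branching. -/
def IsLinearAt (x : V) : Prop :=
  ∀ l m, E.IsWalkFrom x l → E.IsWalkFrom x m → l <+: m ∨ m <+: l

lemma IsLinearAt.endFrom {x : V} (h : E.IsLinearAt x) {l : List Ed} (hl : E.IsWalkFrom x l) :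
    E.IsLinearAt (E.endFrom x l) := fun p q hp hq => by
  simpa only [List.prefix_append_right_inj] using
    h (l ++ p) (l ++ q) (isWalkFrom_append.2 ⟨hl, hp⟩) (isWalkFrom_append.2 ⟨hl, hq⟩)

/-! ### Normal pairs of paths -/

variable (E) in
/-- The pairs of paths `α = (x, l)`, `β = (y, m)` with the same range for which `α β*` is normal:
`α = β`, or one of them extends the other by a closed path without exits. -/
structure IsNormalPair (x : V) (l : List Ed) (y : V) (m : List Ed) : Prop where
  source_eq : x = y
  isWalk_left : E.IsWalkFrom x l
  isWalk_right : E.IsWalkFrom y m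
  range_eq : E.endFrom x l = E.endFrom y m
  eq_or : l = m ∨ E.IsLinearAt (E.endFrom x l) ∧ (l <+: m ∨ m <+: l)

namespace IsNormalPair

variable {x y z : V} {l m k : List Ed}

lemma refl (h : E.IsWalkFrom x l) : E.IsNormalPair x l x l := ⟨rfl, h, h, rfl, .inl rfl⟩

lemma symm (h : E.IsNormalPair x l y m) : E.IsNormalPair y m x l :=
  ⟨h.source_eq.symm, h.isWalk_right, h.isWalk_left, h.range_eq.symm,
    h.eq_or.imp Eq.symm fun h' => ⟨h.range_eq ▸ h'.1, h'.2.symm⟩⟩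

/-- Comparability of paths is not transitive in general: two extensions of the same path may
diverge. Linearity at the common range is what excludes this. -/
lemma trans (h : E.IsNormalPair x l y m) (h' : E.IsNormalPair y m z k) :
    E.IsNormalPair x l z k := by
  refine ⟨h.source_eq.trans h'.source_eq, h.isWalk_left, h'.isWalk_right,
    h.range_eq.trans h'.range_eq, ?_⟩
  obtain ⟨rfl, hl, -, he, h1⟩ := h
  obtain ⟨rfl, hm, hk, he', h2⟩ := h'
  rcases h1 with rfl | ⟨hL, h1⟩
  · exact h2
  rcases h2 with rfl | ⟨-, h2⟩
  · exact .inr ⟨hL, h1⟩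
  refine .inr ⟨hL, ?_⟩
  rcases h1 with h1 | h1 <;> rcases h2 with h2 | h2
  · exact .inl (h1.trans h2)
  · exact List.prefix_or_prefix_of_prefix h1 h2
  -- Both outer paths extend `m`; the two remainders start at the common range, where any two walks
  -- are comparable.
  · obtain ⟨c, rfl⟩ := h1
    obtain ⟨d, rfl⟩ := h2
    simp only [List.prefix_append_right_inj]
    rw [he] at hL
    exact hL _ _ (isWalkFrom_append.1 hl).2 (isWalkFrom_append.1 hk).2
  · exact .inr (h2.trans h1)

/-- This is the compatibility of normality with `α β* = ∑ αe (βe)*`. Passing to the longer pair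
moves along `e`, which preserves linearity. In the other direction, if the paths differ, the longer
one passes through `r(e)` before returning to the common range, so linearity at `r(e)` propagates to
that range. -/
lemma concat_iff {e : Ed} (he : E.s e = E.endFrom y m) :
    E.IsNormalPair x (l ++ [e]) y (m ++ [e]) ↔ E.IsNormalPair x l y m := by
  constructor
  · suffices H : ∀ l m : List Ed, E.s e = E.endFrom x l → E.s e = E.endFrom x m →
        E.IsWalkFrom x l → m ++ [e] <+: l ++ [e] → E.IsLinearAt (E.r e) →
        l = m ∨ E.IsLinearAt (E.endFrom x l) ∧ m <+: l by
      rintro ⟨rfl, hl, hm, h, hlm⟩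
      rw [isWalkFrom_concat] at hl hm
      refine ⟨rfl, hl.1, hm.1, hl.2.symm.trans hm.2, ?_⟩
      rcases hlm with hlm | ⟨hL, hlm⟩
      · exact .inl (List.append_left_injective _ hlm)
      rw [endFrom_append] at hL
      rcases hlm with hlm | hlm
      · rcases H m l hm.2 hl.2 hm.1 hlm hL with h | h
        · exact .inl h.symm
        · rw [← hm.2, hl.2] at h
          exact .inr ⟨h.1, .inl h.2⟩
      · exact (H l m hl.2 hm.2 hl.1 hlm hL).imp id fun h => ⟨h.1, .inr h.2⟩
    rintro l m hl hm hw ⟨d, hd⟩ hL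
    rcases List.eq_nil_or_concat' d with rfl | ⟨d, f, rfl⟩
    · rw [List.append_nil] at hd
      exact .inl (List.append_left_injective _ hd).symm
    -- The surplus `d` ends in the edge `e`; removing it leaves `l = m e d'`, so the range of `l` is
    -- reached from `r(e)` along `d'`.
    · rw [← List.append_assoc] at hd
      obtain ⟨rfl, hf⟩ := List.append_inj' hd rfl
      refine .inr ⟨?_, ⟨[e] ++ d, (List.append_assoc _ _ _).symm⟩⟩
      rw [isWalkFrom_append, endFrom_append] at hw
      rw [endFrom_append, endFrom_append]
      exact IsLinearAt.endFrom hL hw.2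
  · rintro ⟨rfl, hl, hm, h, hlm⟩
    have he' := he.trans h.symm
    refine ⟨rfl, isWalkFrom_concat.2 ⟨hl, he'⟩, isWalkFrom_concat.2 ⟨hm, he⟩, ?_, ?_⟩
    · rw [endFrom_append, endFrom_append, h]
    · rcases hlm with rfl | ⟨hL, hlm⟩
      · exact .inl rfl
      refine .inr ⟨?_, ?_⟩
      · rw [endFrom_append]; exact hL.endFrom (isWalkFrom_singleton.2 he')
      · rcases hlm with ⟨c, rfl⟩ | ⟨c, rfl⟩
        · rw [List.append_assoc, List.prefix_append_right_inj, List.prefix_append_right_inj]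
          refine hL _ _ (isWalkFrom_singleton.2 he') ?_
          exact isWalkFrom_append.2 ⟨(isWalkFrom_append.1 hm).2,
            isWalkFrom_singleton.2 (he.trans (endFrom_append _ _ _))⟩
        · rw [List.append_assoc, List.prefix_append_right_inj, List.prefix_append_right_inj]
          rw [h] at hL
          refine hL _ _ ?_ (isWalkFrom_singleton.2 he)
          exact isWalkFrom_append.2 ⟨(isWalkFrom_append.1 hl).2,
            isWalkFrom_singleton.2 (he'.trans (endFrom_append _ _ _))⟩

lemma append_iff {t : List Ed} (ht : E.IsWalkFrom (E.endFrom y m) t) :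
    E.IsNormalPair x (l ++ t) y (m ++ t) ↔ E.IsNormalPair x l y m := by
  induction t generalizing l m with
  | nil => simp only [List.append_nil]
  | cons e t ih =>
    rw [List.append_cons, List.append_cons m, ih, concat_iff ht.1]
    rw [endFrom_append]; exact ht.2

end IsNormalPair

end DirectedGraph

namespace DirectedGraph

variable {V : Type u} {Ed : Type v} {E : DirectedGraph V Ed}

/-! ### Linear maps out of the Leavitt path algebra -/

section translation

variable (E) (R : Type w) [CommRing R] (A : Type*) [AddCommGroup A] [Module R A]

/-- The module on which `L_R(E)` acts by right translation: the functions on the pairs of lists of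
edges, together with a value at a formal unit, which are compatible with the relation
`α β* = ∑ α e (β e)*` and vanish when the second list is not a walk. -/
def translationModule : Submodule R (A × (V → List Ed → V → List Ed → A)) where
  carrier := {φ | (∀ x l y m (hfin : {e | E.s e = E.endFrom y m}.Finite),
    {e | E.s e = E.endFrom y m}.Nonempty →
      φ.2 x l y m = ∑ e ∈ hfin.toFinset, φ.2 x (l ++ [e]) y (m ++ [e])) ∧
    ∀ x l y m, ¬ E.IsWalkFrom y m → φ.2 x l y m = 0}
  add_mem' hφ hψ := by
    refine ⟨fun x l y m hfin hne => ?_, fun x l y m hm => ?_⟩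
    · simp only [Prod.snd_add, Pi.add_apply, Finset.sum_add_distrib]
      rw [← hφ.1 x l y m hfin hne, ← hψ.1 x l y m hfin hne]
    · simp [hφ.2 x l y m hm, hψ.2 x l y m hm]
  zero_mem' := by simp
  smul_mem' t φ hφ := by
    refine ⟨fun x l y m hfin hne => ?_, fun x l y m hm => ?_⟩
    · simp only [Prod.smul_snd, Pi.smul_apply, ← Finset.smul_sum]
      rw [← hφ.1 x l y m hfin hne]
    · simp [hφ.2 x l y m hm]

open Classical in
/-- Right translation by the vertex `v`. -/
noncomputable def vertTranslation (v : V) :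
    A × (V → List Ed → V → List Ed → A) →ₗ[R] A × (V → List Ed → V → List Ed → A) where
  toFun φ := (φ.2 v [] v [], fun x l y m => if y = v then φ.2 x l y m else 0)
  map_add' φ ψ := by ext <;> simp; split_ifs <;> simp
  map_smul' t φ := by ext <;> simp

open Classical in
/-- Right translation by the edge `e`. -/
noncomputable def edgeTranslation (e : Ed) :
    A × (V → List Ed → V → List Ed → A) →ₗ[R] A × (V → List Ed → V → List Ed → A) where
  toFun φ := (φ.2 (E.s e) [e] (E.r e) [], fun x l y m =>
    match m with
    | [] => if y = E.s e then φ.2 x (l ++ [e]) (E.r e) [] else 0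
    | f :: m => if f = e ∧ y = E.s e then φ.2 x l (E.r e) m else 0)
  map_add' φ ψ := by
    ext x l y m
    · simp
    · cases m <;> simp <;> split_ifs <;> simp
  map_smul' t φ := by
    ext x l y m
    · simp
    · cases m <;> simp

open Classical in
/-- Right translation by the ghost edge `e*`. -/
noncomputable def ghostTranslation (e : Ed) :
    A × (V → List Ed → V → List Ed → A) →ₗ[R] A × (V → List Ed → V → List Ed → A) where
  toFun φ := (φ.2 (E.r e) [] (E.s e) [e], fun x l y m =>
    if y = E.r e then φ.2 x l (E.s e) (e :: m) else 0)
  map_add' φ ψ := by ext <;> simp; split_ifs <;> simp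
  map_smul' t φ := by ext <;> simp

/-- Right translation by a generator. -/
noncomputable def genTranslation :
    Gen V Ed → (A × (V → List Ed → V → List Ed → A) →ₗ[R] A × (V → List Ed → V → List Ed → A))
  | .vert x => vertTranslation R A x
  | .edge e => edgeTranslation E R A e
  | .ghost e => ghostTranslation E R A e

variable {E R A}

lemma genTranslation_mem (g : Gen V Ed) (φ : A × (V → List Ed → V → List Ed → A))
    (hφ : φ ∈ translationModule E R A) :
    genTranslation E R A g φ ∈ translationModule E R A := by
  cases g with
  | vert v =>
    refine ⟨fun x l y m hfin hne => ?_, fun x l y m hm => ?_⟩ <;>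
      simp only [genTranslation, vertTranslation, LinearMap.coe_mk, AddHom.coe_mk] <;>
      split_ifs with h
    · exact hφ.1 x l y m hfin hne
    · simp
    · exact hφ.2 x l y m hm
    · rfl
  | edge e =>
    refine ⟨fun x l y m hfin hne => ?_, fun x l y m hm => ?_⟩ <;> cases m with
    | nil =>
      simp only [genTranslation, edgeTranslation, LinearMap.coe_mk, AddHom.coe_mk, List.nil_append]
      -- Both membership conditions reach this point: the vanishing condition is void because the
      -- empty list is a walk, and the second alternative treats compatibility.
      first
      | exact absurd trivial hm
      | split_ifs with h
        · subst h
          -- In `∑ α f f* e` only the term `f = e` survives.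
          rw [Finset.sum_eq_single e]
          · simp
          · intro f _ hf; simp [hf]
          · intro h; simp [endFrom] at h
        · simp [h]
    | cons f m =>
      simp only [genTranslation, edgeTranslation, LinearMap.coe_mk, AddHom.coe_mk,
        List.cons_append]
      split_ifs with h
      · obtain ⟨rfl, rfl⟩ := h
        first
        | exact hφ.1 x l (E.r f) m hfin hne
        | exact hφ.2 x l (E.r f) m fun h => hm ⟨rfl, h⟩
      · simp
  | ghost e =>
    refine ⟨fun x l y m hfin hne => ?_, fun x l y m hm => ?_⟩ <;>
      simp only [genTranslation, ghostTranslation, LinearMap.coe_mk, AddHom.coe_mk] <;>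
      split_ifs with h
    · subst h
      exact hφ.1 x l (E.s e) (e :: m) hfin hne
    · simp
    · subst h
      exact hφ.2 x l (E.s e) (e :: m) fun h => hm h.2
    · rfl

variable (E R A) in
/-- The action of the generators on `translationModule`. -/
noncomputable def translationOp (g : Gen V Ed) : Module.End R (translationModule E R A) :=
  (genTranslation E R A g).restrict (genTranslation_mem g)

/-- A generator `g` acts by `(gφ)(p) = φ(pg)`, so a product acts by composition in the same order.
The summation relation at a vertex is the compatibility condition built into the module when the
second list is empty; otherwise the first edge of that list selects a single summand. -/
lemma translationOp_rel (a b : Module.End R (translationModule E R A))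
    (h : E.LeavittRel (translationOp E R A) a b) : a = b := by
  refine LinearMap.ext fun φ => Subtype.ext ?_
  obtain ⟨φ, hφ⟩ := φ
  cases h with
  | idem x =>
    refine Prod.ext ?_ ?_
    · simp [translationOp, genTranslation, vertTranslation]
    · funext x l y m
      simp +contextual [translationOp, genTranslation, vertTranslation]
  | orth x y h =>
    refine Prod.ext ?_ ?_
    · simp [translationOp, genTranslation, vertTranslation, h]
    · funext x' l y' m
      simp +contextual [translationOp, genTranslation, vertTranslation, h]
  | source_edge e =>
    refine Prod.ext ?_ ?_
    · simp [translationOp, genTranslation, vertTranslation, edgeTranslation]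
    · funext x l y m
      cases m <;>
        simp +contextual [translationOp, genTranslation, vertTranslation, edgeTranslation]
  | edge_range e =>
    refine Prod.ext ?_ ?_
    · simp [translationOp, genTranslation, vertTranslation, edgeTranslation]
    · funext x l y m
      cases m <;>
        simp +contextual [translationOp, genTranslation, vertTranslation, edgeTranslation]
  | range_ghost e =>
    refine Prod.ext ?_ ?_
    · simp [translationOp, genTranslation, vertTranslation, ghostTranslation]
    · funext x l y m
      simp +contextual [translationOp, genTranslation, vertTranslation, ghostTranslation]
  | ghost_source e =>
    refine Prod.ext ?_ ?_
    · simp [translationOp, genTranslation, vertTranslation, ghostTranslation]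
    · funext x l y m
      simp +contextual [translationOp, genTranslation, vertTranslation, ghostTranslation]
  | ck1_same e =>
    refine Prod.ext ?_ ?_
    · simp [translationOp, genTranslation, vertTranslation, ghostTranslation, edgeTranslation]
    · funext x l y m
      by_cases h : y = E.r e <;>
        simp [translationOp, genTranslation, vertTranslation, ghostTranslation, edgeTranslation, h]
  | ck1_ne e f h =>
    refine Prod.ext ?_ ?_
    · simp [translationOp, genTranslation, ghostTranslation, edgeTranslation, h]
    · funext x l y m
      simp +contextual [translationOp, genTranslation, ghostTranslation, edgeTranslation, h]
  | ck2 x hfin hne =>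
    rw [LinearMap.sum_apply, Submodule.coe_sum]
    refine Prod.ext ?_ ?_
    · rw [Prod.fst_sum]
      simp only [translationOp, genTranslation, vertTranslation, ghostTranslation, edgeTranslation,
        Module.End.mul_apply, LinearMap.coe_restrict_apply, LinearMap.coe_mk, AddHom.coe_mk]
      refine (hφ.1 x [] x [] hfin hne).trans (Finset.sum_congr rfl fun e he => ?_)
      obtain rfl : E.s e = x := by simpa using he
      simp
    · rw [Prod.snd_sum]
      funext x' l y m
      simp only [Finset.sum_apply]
      simp only [translationOp, genTranslation, vertTranslation, ghostTranslation, edgeTranslation,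
        Module.End.mul_apply, LinearMap.coe_restrict_apply, LinearMap.coe_mk, AddHom.coe_mk]
      split_ifs with h
      · subst h
        cases m with
        | nil =>
          refine (hφ.1 x' l y [] hfin hne).trans (Finset.sum_congr rfl fun e he => ?_)
          obtain rfl : E.s e = y := by simpa using he
          simp
        | cons f m =>
          by_cases hf : E.s f = y
          · subst hf
            rw [Finset.sum_eq_single f]
            · simp
            · intro e he hef
              simp [hef.symm]
            · intro h; simp at h
          -- Here the list does not start at `y`, so every summand is zero; the vanishing condition
          -- of the module makes the left side zero too.
          · rw [hφ.2 x' l y (f :: m) fun h => hf h.1]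
            refine (Finset.sum_eq_zero fun e he => ?_).symm
            obtain rfl : E.s e = y := by simpa using he
            have : f ≠ e := fun h => hf (h ▸ rfl)
            simp [this]
      · refine (Finset.sum_eq_zero fun e he => ?_).symm
        obtain rfl : E.s e = x := by simpa using he
        cases m <;> simp [h]

variable (E R A) in
/-- The action of `L_R(E)` on `translationModule`. -/
noncomputable def translationRep :
    E.LeavittPathAlgebra R →ₙₐ[R] Module.End R (translationModule E R A) :=
  LeavittPathAlgebra.lift (translationOp E R A) translationOp_rel

lemma translationRep_gen (g : Gen V Ed) :
    translationRep E R A (LeavittPathAlgebra.gen E R g) = translationOp E R A g :=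
  LeavittPathAlgebra.lift_gen _ _ g

/-! ### Values of the translation action on monomials -/

open LeavittPathAlgebra

lemma translationRep_walkElem {y : V} {m : List Ed} (hm : E.IsWalkFrom y m)
    (φ : translationModule E R A) (x : V) (l : List Ed) :
    (translationRep E R A (walkElem E R y m) φ).1.2 x l y [] =
      φ.1.2 x (l ++ m) (E.endFrom y m) [] := by
  induction m generalizing y l φ with
  | nil =>
    rw [walkElem, translationRep_gen]
    simp [translationOp, genTranslation, vertTranslation, endFrom]
  | cons e m ih =>
    obtain ⟨rfl, hm⟩ := hm
    rw [walkElem, _root_.map_mul, Module.End.mul_apply, translationRep_gen]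
    simp only [translationOp, genTranslation, edgeTranslation, LinearMap.coe_restrict_apply,
      LinearMap.coe_mk, AddHom.coe_mk, if_true]
    rw [ih hm, endFrom, ← List.append_cons]

lemma translationRep_star_walkElem {y : V} {m : List Ed} (hm : E.IsWalkFrom y m)
    (φ : translationModule E R A) (x : V) (l m' : List Ed) :
    (translationRep E R A (star (walkElem E R y m)) φ).1.2 x l (E.endFrom y m) m' =
      φ.1.2 x l y (m ++ m') := by
  induction m generalizing y m' φ with
  | nil =>
    rw [walkElem, star_gen, starGen, translationRep_gen]
    simp [translationOp, genTranslation, vertTranslation, endFrom]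
  | cons e m ih =>
    obtain ⟨rfl, hm⟩ := hm
    rw [walkElem, star_mul, _root_.map_mul, Module.End.mul_apply, endFrom, ih hm, star_gen, starGen,
      translationRep_gen]
    simp [translationOp, genTranslation, ghostTranslation, LinearMap.coe_restrict_apply]

lemma translationRep_walkElem_fst {y : V} {m : List Ed} (hm : E.IsWalkFrom y m)
    (φ : translationModule E R A) :
    (translationRep E R A (walkElem E R y m) φ).1.1 = φ.1.2 y m (E.endFrom y m) [] := by
  cases m with
  | nil =>
    rw [walkElem, translationRep_gen]
    simp [translationOp, genTranslation, vertTranslation, endFrom]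
  | cons e m =>
    obtain ⟨rfl, hm⟩ := hm
    rw [walkElem, _root_.map_mul, Module.End.mul_apply, translationRep_gen]
    simp only [translationOp, genTranslation, edgeTranslation, LinearMap.coe_restrict_apply,
      LinearMap.coe_mk, AddHom.coe_mk]
    rw [translationRep_walkElem hm]
    rfl

/-- A function on pairs of walks which is compatible with the relation `α β* = ∑ α e (β e)*`
extends to a linear map on `L_R(E)`. -/
theorem exists_linearMap (φ : V → List Ed → V → List Ed → A)
    (hφ : ∀ x l y m (hfin : {e | E.s e = E.endFrom y m}.Finite),
      {e | E.s e = E.endFrom y m}.Nonempty →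
        φ x l y m = ∑ e ∈ hfin.toFinset, φ x (l ++ [e]) y (m ++ [e]))
    (hφ₀ : ∀ x l y m, ¬ E.IsWalkFrom y m → φ x l y m = 0) :
    ∃ F : E.LeavittPathAlgebra R →ₗ[R] A, ∀ x l y m, E.IsWalkFrom x l → E.IsWalkFrom y m →
      E.endFrom x l = E.endFrom y m →
      F (walkElem E R x l * star (walkElem E R y m)) = φ x l y m := by
  -- The functional is the value of `aΦ` at the formal unit, heuristically `Φ(1·a)`. The coordinate
  -- `0` is arbitrary: every generator computes its result from the second component only.
  let Φ : translationModule E R A := ⟨(0, φ), hφ, hφ₀⟩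
  refine ⟨{ toFun := fun a => (translationRep E R A a Φ).1.1
            map_add' := fun a b => by simp
            map_smul' := fun t a => by simp }, fun x l y m hl hm h => ?_⟩
  simp only [LinearMap.coe_mk, AddHom.coe_mk]
  rw [_root_.map_mul, Module.End.mul_apply, translationRep_walkElem_fst hl, h,
    translationRep_star_walkElem hm, List.append_nil]

end translation

end DirectedGraph

namespace DirectedGraph

namespace LeavittPathAlgebra

variable {V : Type u} {Ed : Type v} {E : DirectedGraph V Ed} {R : Type w} [CommRing R]

/-! ### Monomials -/

lemma vert_mul_walkElem {x : V} {l : List Ed} (hl : E.IsWalkFrom x l) :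
    gen E R (.vert x) * walkElem E R x l = walkElem E R x l := by
  cases l with
  | nil => exact gen_rel (.idem x)
  | cons e l =>
    obtain ⟨rfl, hl⟩ := hl
    rw [walkElem, ← mul_assoc, gen_rel (.source_edge e)]

lemma walkElem_mul_vert (x : V) (l : List Ed) :
    walkElem E R x l * gen E R (.vert (E.endFrom x l)) = walkElem E R x l := by
  induction l generalizing x with
  | nil => exact gen_rel (.idem x)
  | cons e l ih => rw [walkElem, mul_assoc, endFrom, ih]

lemma walkElem_append {x : V} {l m : List Ed} (hm : E.IsWalkFrom (E.endFrom x l) m) :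
    walkElem E R x (l ++ m) = walkElem E R x l * walkElem E R (E.endFrom x l) m := by
  induction l generalizing x with
  | nil => exact (vert_mul_walkElem hm).symm
  | cons e l ih => rw [List.cons_append, walkElem, walkElem, endFrom, ih hm, mul_assoc]

lemma walkElem_singleton (x : V) (e : Ed) : walkElem E R x [e] = gen E R (.edge e) :=
  gen_rel (.edge_range e)

lemma walkElem_concat {x : V} {l : List Ed} {e : Ed} (he : E.s e = E.endFrom x l) :
    walkElem E R x (l ++ [e]) = walkElem E R x l * gen E R (.edge e) := by
  rw [walkElem_append (isWalkFrom_singleton.2 he), walkElem_singleton]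

lemma star_vert (x : V) : star (gen E R (.vert x)) = gen E R (.vert x) := star_gen _

lemma star_edge (e : Ed) : star (gen E R (.edge e)) = gen E R (.ghost e) := star_gen _

lemma star_walkElem_mul_self {x : V} {l : List Ed} (hl : E.IsWalkFrom x l) :
    star (walkElem E R x l) * walkElem E R x l = gen E R (.vert (E.endFrom x l)) := by
  induction l generalizing x with
  | nil => rw [walkElem, star_vert]; exact gen_rel (.idem x)
  | cons e l ih =>
    obtain ⟨rfl, hl⟩ := hl
    rw [walkElem, star_mul, mul_assoc, ← mul_assoc (star (gen E R (.edge e))), star_edge,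
      gen_rel (.ck1_same e), vert_mul_walkElem hl, ih hl, endFrom]

lemma star_walkElem_mul_append {x : V} {l t : List Ed} (hl : E.IsWalkFrom x (l ++ t)) :
    star (walkElem E R x l) * walkElem E R x (l ++ t) = walkElem E R (E.endFrom x l) t := by
  obtain ⟨hl, ht⟩ := isWalkFrom_append.1 hl
  rw [walkElem_append ht, ← mul_assoc, star_walkElem_mul_self hl, vert_mul_walkElem ht]

lemma star_walkElem_mul_eq_zero {x y : V} {l m : List Ed} (hl : E.IsWalkFrom x l)
    (hm : E.IsWalkFrom y m) (h : x = y → ¬ (l <+: m ∨ m <+: l)) :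
    star (walkElem E R x l) * walkElem E R y m = 0 := by
  by_cases hxy : x = y
  · subst hxy
    replace h := h rfl
    induction l generalizing x m with
    | nil => exact absurd (.inl (List.nil_prefix)) h
    | cons e l ih =>
      cases m with
      | nil => exact absurd (.inr (List.nil_prefix)) h
      | cons f m =>
        obtain ⟨rfl, hl⟩ := hl
        rw [walkElem, walkElem, star_mul, mul_assoc, ← mul_assoc (star (gen E R (.edge e))),
          star_edge]
        by_cases hef : e = f
        · subst hef
          rw [gen_rel (.ck1_same e), vert_mul_walkElem hm.2]
          simp only [List.prefix_cons_inj] at h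
          exact ih hl hm.2 h
        · rw [gen_rel (.ck1_ne e f hef), zero_mul, mul_zero]
  · rw [← vert_mul_walkElem hl, ← vert_mul_walkElem hm, star_mul, star_vert, mul_assoc,
      ← mul_assoc (gen E R _), gen_rel (.orth x y hxy), zero_mul, mul_zero]

/-- If a vertex emits finitely many edges, but at least one, then `α β* = ∑ α e (β e)*`. -/
lemma monomial_eq_sum {x y : V} {l m : List Ed} (h : E.endFrom x l = E.endFrom y m)
    (hfin : {e | E.s e = E.endFrom y m}.Finite) (hne : {e | E.s e = E.endFrom y m}.Nonempty) :
    walkElem E R x l * star (walkElem E R y m) =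
      ∑ e ∈ hfin.toFinset, walkElem E R x (l ++ [e]) * star (walkElem E R y (m ++ [e])) := by
  have key : ∀ e ∈ hfin.toFinset,
      walkElem E R x (l ++ [e]) * star (walkElem E R y (m ++ [e])) =
        walkElem E R x l * (gen E R (.edge e) * gen E R (.ghost e)) *
          star (walkElem E R y m) := by
    intro e he
    have he : E.s e = E.endFrom y m := by simpa using he
    rw [walkElem_concat he, walkElem_concat (he.trans h.symm), star_mul, star_edge]
    simp only [mul_assoc]
  rw [Finset.sum_congr rfl key, ← Finset.sum_mul, ← Finset.mul_sum, ← gen_rel (.ck2 _ hfin hne),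
    ← h, walkElem_mul_vert]

/-- If `R` is nontrivial, then the vertices are nonzero in `L_R(E)`. -/
lemma vert_ne_zero [Nontrivial R] (x : V) : gen E R (.vert x) ≠ 0 := by
  classical
  -- Choose one edge out of every vertex that is not a sink. The functional that is `1` on `α α*`
  -- when all edges of `α` are chosen, and `0` on all other pairs, respects the summation relation
  -- because exactly one extension `αe` of a chosen path is again chosen. It takes the value `1` at
  -- every vertex.
  let C : Set Ed := Set.range fun x : {x : V // ∃ e, E.s e = x} => x.2.choose
  have hC : ∀ e, ∃! f, f ∈ C ∧ E.s f = E.s e := by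
    intro e
    have h : ∃ f, E.s f = E.s e := ⟨e, rfl⟩
    refine ⟨h.choose, ⟨⟨⟨E.s e, h⟩, rfl⟩, h.choose_spec⟩, ?_⟩
    rintro _ ⟨⟨⟨y, hy⟩, rfl⟩, hf⟩
    have : y = E.s e := hy.choose_spec.symm.trans hf
    subst this
    rfl
  obtain ⟨F, hF⟩ := exists_linearMap (E := E) (R := R) (A := R)
    (fun x l y m => if (E.IsWalkFrom x l ∧ x = y ∧ l = m) ∧ ∀ e ∈ l, e ∈ C then 1 else 0)
    (by
      rintro x l y m hfin ⟨e, he⟩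
      rw [Set.mem_ofPred_eq] at he
      by_cases h : (E.IsWalkFrom x l ∧ x = y ∧ l = m) ∧ ∀ e ∈ l, e ∈ C
      · obtain ⟨f, ⟨hfC, hf⟩, huniq⟩ := hC e
        rw [if_pos h, Finset.sum_eq_single f, if_pos]
        · obtain ⟨⟨h1, rfl, rfl⟩, h2⟩ := h
          refine ⟨⟨isWalkFrom_concat.2 ⟨h1, hf.trans he⟩, rfl, rfl⟩, ?_⟩
          intro g hg
          rcases List.mem_append.1 hg with hg | hg
          · exact h2 g hg
          · rwa [List.mem_singleton.1 hg]
        · intro g hg hgf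
          rw [if_neg]
          rintro ⟨-, h2⟩
          refine hgf (huniq g ⟨h2 g (by simp), ?_⟩)
          rw [he]; simpa using hg
        · intro hf'
          exact absurd (by simpa [he] using hf) hf'
      · rw [if_neg h]
        refine (Finset.sum_eq_zero fun f hf => if_neg ?_).symm
        rintro ⟨⟨h1, h2, h3⟩, h4⟩
        exact h ⟨⟨(isWalkFrom_concat.1 h1).1, h2, List.append_left_injective _ h3⟩,
          fun g hg => h4 g (List.mem_append_left _ hg)⟩)
    (by
      intro x l y m hm
      rw [if_neg]
      rintro ⟨⟨h1, rfl, rfl⟩, -⟩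
      exact hm h1)
  intro h0
  have := hF x [] x [] trivial trivial rfl
  rw [walkElem, star_vert, gen_rel (.idem x), h0, map_zero, if_pos] at this
  · exact zero_ne_one this
  · simp [IsWalkFrom]

/-- A walk starting at a vertex which does not lead to a branching is unitary. -/
lemma walkElem_mul_star_of_isLinearAt {x : V} {l : List Ed} (hx : E.IsLinearAt x)
    (hl : E.IsWalkFrom x l) : walkElem E R x l * star (walkElem E R x l) = gen E R (.vert x) := by
  induction l generalizing x with
  | nil => rw [walkElem, star_vert]; exact gen_rel (.idem x)
  | cons e l ih =>
    obtain ⟨rfl, hl⟩ := hl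
    -- Linearity makes `e` the only edge leaving its source, so the summation relation there reads
    -- `s(e) = e e*`.
    have h1 : {f | E.s f = E.s e} = {e} := by
      ext f
      refine ⟨fun hf => ?_, fun hf => congrArg E.s hf⟩
      have := hx [e] [f] (isWalkFrom_singleton.2 rfl) (isWalkFrom_singleton.2 hf)
      simpa [eq_comm] using this
    have hfin : {f | E.s f = E.s e}.Finite := h1 ▸ Set.finite_singleton e
    have h2 : hfin.toFinset = {e} := by
      ext f; simpa using Set.ext_iff.1 h1 f
    rw [walkElem, star_mul, mul_assoc, ← mul_assoc (walkElem E R (E.r e) l),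
      ih (x := E.r e) (hx.endFrom (l := [e]) (isWalkFrom_singleton.2 rfl)) hl, star_edge,
      gen_rel (.range_ghost e), gen_rel (.ck2 (E.s e) hfin ⟨e, rfl⟩), h2, Finset.sum_singleton]

/-! ### Normality in terms of range projections -/

/-- Continuing a path by a walk `c` from a linear vertex does not change its range projection, since
`c c*` is that vertex. -/
lemma range_projection_of_isNormalPair {x y : V} {l m : List Ed} (h : E.IsNormalPair x l y m) :
    walkElem E R x l * star (walkElem E R x l) = walkElem E R y m * star (walkElem E R y m) := by
  have key : ∀ l c : List Ed, E.IsWalkFrom x (l ++ c) → E.IsLinearAt (E.endFrom x l) →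
      walkElem E R x (l ++ c) * star (walkElem E R x (l ++ c)) =
        walkElem E R x l * star (walkElem E R x l) := by
    intro l c h hL
    obtain ⟨-, hc⟩ := isWalkFrom_append.1 h
    rw [walkElem_append hc, star_mul, mul_assoc, ← mul_assoc (walkElem E R (E.endFrom x l) c),
      walkElem_mul_star_of_isLinearAt hL hc, ← mul_assoc, walkElem_mul_vert]
  obtain ⟨rfl, hl, hm, he, rfl | ⟨hL, ⟨c, rfl⟩ | ⟨c, rfl⟩⟩⟩ := h
  · rfl
  · exact (key l c hm hL).symm
  · exact key m c hl (he ▸ hL)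

/-- If a walk `p` from `x` were incomparable with `c`, then `p* c = 0` and `r(p) = p* x p = p* c c*
p = 0`, which is impossible. So every walk from `x` is comparable with `c`. If two walks both begin
with `c`, strip it off: `c` returns to `x`, and induction on the total length applies. -/
lemma isLinearAt_of_mul_star [Nontrivial R] {x : V} {c : List Ed} (hc : E.IsWalkFrom x c)
    (hne : c ≠ []) (hx : E.endFrom x c = x)
    (h : walkElem E R x c * star (walkElem E R x c) = gen E R (.vert x)) : E.IsLinearAt x := by
  have key : ∀ p, E.IsWalkFrom x p → p <+: c ∨ c <+: p := by
    intro p hp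
    by_contra H
    refine vert_ne_zero (E := E) (R := R) (E.endFrom x p) ?_
    rw [← star_walkElem_mul_self hp]
    nth_rw 2 [← vert_mul_walkElem hp]
    rw [← h, ← mul_assoc, ← mul_assoc, star_walkElem_mul_eq_zero hp hc fun _ => H, zero_mul,
      zero_mul]
  have main : ∀ n (p q : List Ed), p.length + q.length ≤ n → E.IsWalkFrom x p →
      E.IsWalkFrom x q → p <+: q ∨ q <+: p := by
    have hlen : 0 < c.length := List.length_pos_iff.2 hne
    intro n
    induction n with
    | zero =>
      intro p q hn
      have : p = [] := List.length_eq_zero_iff.1 (by omega)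
      subst this
      exact fun _ _ => .inl List.nil_prefix
    | succ n ih =>
      intro p q hn hp hq
      rcases key p hp with h1 | ⟨p, rfl⟩ <;> rcases key q hq with h2 | ⟨q, rfl⟩
      · exact List.prefix_or_prefix_of_prefix h1 h2
      · exact .inl (h1.trans (List.prefix_append _ _))
      · exact .inr (h2.trans (List.prefix_append _ _))
      · simp only [List.prefix_append_right_inj]
        rw [isWalkFrom_append, hx] at hp hq
        simp only [List.length_append] at hn
        exact ih p q (by omega) hp.2 hq.2
  exact fun p q => main _ p q le_rfl

/-- For incomparable paths `α* β = 0`, so `r(β) = β* (β β*) β = β* α α* β = 0`, a contradiction. If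
one path is the other followed by `c`, then `c` is closed because the ranges agree, and conjugating
the equality of projections yields `c c* = r(α)`. -/
lemma isNormalPair_of_range_projection [Nontrivial R] {x y : V} {l m : List Ed}
    (hl : E.IsWalkFrom x l) (hm : E.IsWalkFrom y m) (he : E.endFrom x l = E.endFrom y m)
    (h : walkElem E R x l * star (walkElem E R x l) = walkElem E R y m * star (walkElem E R y m)) :
    E.IsNormalPair x l y m := by
  by_cases H : x = y → ¬ (l <+: m ∨ m <+: l)
  · exfalso
    refine vert_ne_zero (E := E) (R := R) (E.endFrom y m) ?_
    calc gen E R (.vert (E.endFrom y m))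
        = star (walkElem E R y m) * walkElem E R y m * (star (walkElem E R y m) *
            walkElem E R y m) := by
          rw [star_walkElem_mul_self hm]; exact (gen_rel (.idem _)).symm
      _ = star (walkElem E R y m) * (walkElem E R y m * star (walkElem E R y m)) *
            walkElem E R y m := by simp only [mul_assoc]
      _ = star (star (walkElem E R x l) * walkElem E R y m) *
            (star (walkElem E R x l) * walkElem E R y m) := by
          rw [← h, star_mul, star_star]; simp only [mul_assoc]
      _ = 0 := by rw [star_walkElem_mul_eq_zero hl hm H, mul_zero]
  push Not at H
  obtain ⟨rfl, H⟩ := H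
  refine ⟨rfl, hl, hm, he, ?_⟩
  have key : ∀ l c : List Ed, E.IsWalkFrom x (l ++ c) → E.endFrom x l = E.endFrom x (l ++ c) →
      walkElem E R x (l ++ c) * star (walkElem E R x (l ++ c)) =
        walkElem E R x l * star (walkElem E R x l) →
      c = [] ∨ E.IsLinearAt (E.endFrom x l) := by
    intro l c h he H
    obtain ⟨h1, hc⟩ := isWalkFrom_append.1 h
    by_cases hne : c = []
    · exact .inl hne
    refine .inr (isLinearAt_of_mul_star (R := R) hc hne ?_ ?_)
    · rw [endFrom_append] at he; exact he.symm
    -- Compression by the shorter path turns the hypothesis into `c c*` equal to the vertex at which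
    -- `c` starts.
    have H' := congrArg (fun a => star (walkElem E R x l) * a * walkElem E R x l) H
    simp only [walkElem_append hc, star_mul] at H'
    have e1 : star (walkElem E R x l) * (walkElem E R x l * walkElem E R (E.endFrom x l) c *
        (star (walkElem E R (E.endFrom x l) c) * star (walkElem E R x l))) * walkElem E R x l =
        (star (walkElem E R x l) * walkElem E R x l) * walkElem E R (E.endFrom x l) c *
          star ((star (walkElem E R x l) * walkElem E R x l) * walkElem E R (E.endFrom x l) c) := by
      simp only [star_mul, star_star, mul_assoc]
    have e2 : star (walkElem E R x l) * (walkElem E R x l * star (walkElem E R x l)) *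
        walkElem E R x l = (star (walkElem E R x l) * walkElem E R x l) *
          (star (walkElem E R x l) * walkElem E R x l) := by simp only [mul_assoc]
    rw [e1, e2, star_walkElem_mul_self h1, gen_rel (.idem _), vert_mul_walkElem hc] at H'
    exact H'
  rcases H with ⟨c, rfl⟩ | ⟨c, rfl⟩
  · rcases key l c hm he h.symm with rfl | hL
    · exact .inl (List.append_nil l).symm
    · exact .inr ⟨hL, .inl (List.prefix_append _ _)⟩
  · rcases key m c hl he.symm h with rfl | hL
    · exact .inl (List.append_nil m)
    · exact .inr ⟨he ▸ hL, .inr (List.prefix_append _ _)⟩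

lemma monomial_mul_star {x y : V} {l m : List Ed} (hm : E.IsWalkFrom y m)
    (h : E.endFrom x l = E.endFrom y m) :
    walkElem E R x l * star (walkElem E R y m) *
      star (walkElem E R x l * star (walkElem E R y m)) =
        walkElem E R x l * star (walkElem E R x l) := by
  rw [star_mul, star_star, mul_assoc, ← mul_assoc (star (walkElem E R y m)),
    star_walkElem_mul_self hm, ← h, ← mul_assoc, walkElem_mul_vert]

lemma monomial_mul_star' {x y : V} {l m : List Ed} (hl : E.IsWalkFrom x l)
    (h : E.endFrom x l = E.endFrom y m) :
    star (walkElem E R x l * star (walkElem E R y m)) *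
      (walkElem E R x l * star (walkElem E R y m)) =
        walkElem E R y m * star (walkElem E R y m) := by
  rw [star_mul, star_star, mul_assoc, ← mul_assoc (star (walkElem E R x l)),
    star_walkElem_mul_self hl, h, ← mul_assoc, walkElem_mul_vert]

lemma mem_standardGens_iff {a : E.LeavittPathAlgebra R} :
    a ∈ standardGens E R ↔ ∃ x l y m, E.IsWalkFrom x l ∧ E.IsWalkFrom y m ∧
      E.endFrom x l = E.endFrom y m ∧ a = walkElem E R x l * star (walkElem E R y m) := by
  constructor
  · rintro ⟨⟨x, l, hl⟩, ⟨y, m, hm⟩, h, rfl⟩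
    exact ⟨x, l, y, m, hl, hm, h, rfl⟩
  · rintro ⟨x, l, y, m, hl, hm, h, rfl⟩
    exact ⟨⟨x, l, hl⟩, ⟨y, m, hm⟩, h, rfl⟩

lemma mem_normalGens_of_isNormalPair {x y : V} {l m : List Ed} (h : E.IsNormalPair x l y m) :
    walkElem E R x l * star (walkElem E R y m) ∈ normalGens E R := by
  refine ⟨mem_standardGens_iff.2 ⟨x, l, y, m, h.2, h.3, h.4, rfl⟩, ?_⟩
  rw [monomial_mul_star h.3 h.4, monomial_mul_star' h.2 h.4, range_projection_of_isNormalPair h]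

lemma mem_normalGens_iff [Nontrivial R] {a : E.LeavittPathAlgebra R} :
    a ∈ normalGens E R ↔ ∃ x l y m, E.IsNormalPair x l y m ∧
      a = walkElem E R x l * star (walkElem E R y m) := by
  constructor
  · rintro ⟨ha, h⟩
    obtain ⟨x, l, y, m, hl, hm, he, rfl⟩ := mem_standardGens_iff.1 ha
    rw [monomial_mul_star hm he, monomial_mul_star' hl he] at h
    exact ⟨x, l, y, m, isNormalPair_of_range_projection hl hm he h, rfl⟩
  · rintro ⟨x, l, y, m, h, rfl⟩
    exact mem_normalGens_of_isNormalPair h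

/-! ### Products of monomials -/

lemma monomial_mul_of_prefix {x y z : V} {l m t k : List Ed} (hm : E.IsWalkFrom y (m ++ t))
    (h : E.endFrom x l = E.endFrom y m) :
    walkElem E R x l * star (walkElem E R y m) *
      (walkElem E R y (m ++ t) * star (walkElem E R z k)) =
        walkElem E R x (l ++ t) * star (walkElem E R z k) := by
  have ht := (isWalkFrom_append.1 hm).2
  rw [← mul_assoc, mul_assoc (walkElem E R x l), star_walkElem_mul_append hm,
    walkElem_append (h ▸ ht), h]

lemma monomial_mul_of_prefix' {x y z : V} {l m t k : List Ed} (hm : E.IsWalkFrom y (m ++ t))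
    (h : E.endFrom z k = E.endFrom y m) :
    walkElem E R x l * star (walkElem E R y (m ++ t)) *
      (walkElem E R y m * star (walkElem E R z k)) =
        walkElem E R x l * star (walkElem E R z (k ++ t)) := by
  apply star_injective
  simpa only [star_mul, star_star] using monomial_mul_of_prefix hm h

lemma monomial_mul_eq_zero {x y y' z : V} {l m m' k : List Ed} (hm : E.IsWalkFrom y m)
    (hm' : E.IsWalkFrom y' m') (h : y = y' → ¬ (m <+: m' ∨ m' <+: m)) :
    walkElem E R x l * star (walkElem E R y m) *
      (walkElem E R y' m' * star (walkElem E R z k)) = 0 := by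
  rw [← mul_assoc, mul_assoc (walkElem E R x l), star_walkElem_mul_eq_zero hm hm' h, mul_zero,
    zero_mul]

lemma mul_mem_standardGens {a b : E.LeavittPathAlgebra R} (ha : a ∈ standardGens E R)
    (hb : b ∈ standardGens E R) : a * b = 0 ∨ a * b ∈ standardGens E R := by
  rw [mem_standardGens_iff] at ha hb ⊢
  obtain ⟨x, l, y, m, hl, hm, h, rfl⟩ := ha
  obtain ⟨y', m', z, k, hm', hk, h', rfl⟩ := hb
  by_cases H : y = y' → ¬ (m <+: m' ∨ m' <+: m)
  · exact .inl (monomial_mul_eq_zero hm hm' H)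
  push Not at H
  obtain ⟨rfl, ⟨t, rfl⟩ | ⟨t, rfl⟩⟩ := H
  · refine .inr ⟨x, l ++ t, z, k, isWalkFrom_append.2 ⟨hl, ?_⟩, hk, ?_,
      monomial_mul_of_prefix hm' h⟩
    · rw [h]; exact (isWalkFrom_append.1 hm').2
    · rw [endFrom_append, h, ← endFrom_append, h']
  · refine .inr ⟨x, l, z, k ++ t, hl, isWalkFrom_append.2 ⟨hk, ?_⟩, ?_,
      monomial_mul_of_prefix' hm h'.symm⟩
    · rw [← h']; exact (isWalkFrom_append.1 hm).2
    · rw [h, endFrom_append, endFrom_append, h']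

lemma star_mem_standardGens {a : E.LeavittPathAlgebra R} (ha : a ∈ standardGens E R) :
    star a ∈ standardGens E R := by
  obtain ⟨α, β, h, rfl⟩ := ha
  exact ⟨β, α, h.symm, by rw [star_mul, star_star]⟩

lemma gen_mem_standardGens (g : Gen V Ed) : gen E R g ∈ standardGens E R := by
  rw [mem_standardGens_iff]
  cases g with
  | vert x =>
    refine ⟨x, [], x, [], trivial, trivial, rfl, ?_⟩
    rw [walkElem, star_vert, gen_rel (.idem x)]
  | edge e =>
    refine ⟨E.s e, [e], E.r e, [], isWalkFrom_singleton.2 rfl, trivial, rfl, ?_⟩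
    rw [walkElem_singleton, walkElem, star_vert, gen_rel (.edge_range e)]
  | ghost e =>
    refine ⟨E.r e, [], E.s e, [e], trivial, isWalkFrom_singleton.2 rfl, rfl, ?_⟩
    rw [walkElem_singleton, walkElem, star_edge, gen_rel (.range_ghost e)]

/-- The generators lie in `G_E`, and `G_E` together with `0` is closed under products. Hence left
multiplication by a generator preserves the span, and recursion on words reaches all of the algebra.
-/
lemma span_standardGens : Submodule.span R (standardGens E R) = ⊤ := by
  have hmul : ∀ (g : Gen V Ed), ∀ a ∈ Submodule.span R (standardGens E R),
      gen E R g * a ∈ Submodule.span R (standardGens E R) := by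
    intro g a ha
    induction ha using Submodule.span_induction with
    | mem a ha =>
      rcases mul_mem_standardGens (gen_mem_standardGens g) ha with h | h
      · rw [h]; exact Submodule.zero_mem _
      · exact Submodule.subset_span h
    | zero => rw [mul_zero]; exact Submodule.zero_mem _
    | add a b _ _ ha hb => rw [mul_add]; exact Submodule.add_mem _ ha hb
    | smul t a _ ha => rw [mul_smul_comm]; exact Submodule.smul_mem _ t ha
  have hword : ∀ w : FreeSemigroup (Gen V Ed),
      mk E R (MonoidAlgebra.single w 1) ∈ Submodule.span R (standardGens E R) := by
    intro w
    induction w using FreeSemigroup.recOnMul with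
    | ih1 g => exact Submodule.subset_span (gen_mem_standardGens g)
    | ih2 g w _ hw =>
      have : (MonoidAlgebra.single (FreeSemigroup.of g * w) 1 : FreeGenAlgebra R V Ed) =
          freeGen R g * MonoidAlgebra.single w 1 := by
        rw [freeGen, MonoidAlgebra.single_mul_single, one_mul]
      rw [this, mk_mul]
      exact hmul g _ hw
  rw [eq_top_iff]
  rintro a -
  obtain ⟨a, rfl⟩ := mk_surjective a
  induction a using MonoidAlgebra.induction_linear with
  | zero => exact Submodule.zero_mem _
  | add a b ha hb => exact Submodule.add_mem _ ha hb
  | single w t =>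
    have : (MonoidAlgebra.single w t : FreeGenAlgebra R V Ed) = t • MonoidAlgebra.single w 1 := by
      rw [MonoidAlgebra.smul_single, smul_eq_mul, mul_one]
    rw [this, mk_smul]
    exact Submodule.smul_mem _ t (hword w)

lemma mem_span_standardGens (a : E.LeavittPathAlgebra R) :
    a ∈ Submodule.span R (standardGens E R) := by
  rw [span_standardGens]; exact Submodule.mem_top

lemma linearMap_ext {A : Type*} [AddCommGroup A] [Module R A]
    {F G : E.LeavittPathAlgebra R →ₗ[R] A} (h : ∀ a ∈ standardGens E R, F a = G a) : F = G :=
  LinearMap.ext_on span_standardGens h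

/-- The elements of `G_E` are partial isometries. -/
lemma mul_star_mul_self {g : E.LeavittPathAlgebra R} (hg : g ∈ standardGens E R) :
    g * star g * g = g := by
  obtain ⟨x, l, y, m, hl, hm, h, rfl⟩ := mem_standardGens_iff.1 hg
  rw [monomial_mul_star hm h, ← mul_assoc, mul_assoc (walkElem E R x l),
    star_walkElem_mul_self hl, walkElem_mul_vert]

lemma star_mul_mul_star {g : E.LeavittPathAlgebra R} (hg : g ∈ standardGens E R) :
    star g * g * star g = star g := by
  have := mul_star_mul_self (star_mem_standardGens hg)
  rwa [star_star] at this

/-- The product of two projections `α α*` is zero or the projection of the longer path. In either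
case it is self-adjoint, which for self-adjoint factors means that they commute. -/
lemma range_projections_commute {g h : E.LeavittPathAlgebra R} (hg : g ∈ standardGens E R)
    (hh : h ∈ standardGens E R) :
    g * star g * (h * star h) = h * star h * (g * star g) := by
  suffices H : star (g * star g * (h * star h)) = g * star g * (h * star h) by
    rw [← H]; simp only [star_mul, star_star]
  obtain ⟨x, l, y, m, hl, hm, he, rfl⟩ := mem_standardGens_iff.1 hg
  obtain ⟨x', l', y', m', hl', hm', he', rfl⟩ := mem_standardGens_iff.1 hh
  rw [monomial_mul_star hm he, monomial_mul_star hm' he']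
  by_cases H : x = x' → ¬ (l <+: l' ∨ l' <+: l)
  · rw [monomial_mul_eq_zero hl hl' H, star_zero]
  push Not at H
  obtain ⟨rfl, ⟨t, rfl⟩ | ⟨t, rfl⟩⟩ := H
  · rw [monomial_mul_of_prefix hl' rfl, star_mul, star_star]
  · rw [monomial_mul_of_prefix' hl rfl, star_mul, star_star]

lemma mul_star_mem_normalGens {g : E.LeavittPathAlgebra R} (hg : g ∈ standardGens E R) :
    g * star g ∈ normalGens E R := by
  obtain ⟨x, l, y, m, hl, hm, he, rfl⟩ := mem_standardGens_iff.1 hg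
  rw [monomial_mul_star hm he]
  exact mem_normalGens_of_isNormalPair (.refl hl)

lemma star_mem_commutativeCore {b : E.LeavittPathAlgebra R} (hb : b ∈ commutativeCore E R) :
    star b ∈ commutativeCore E R := by
  induction hb using NonUnitalAlgebra.adjoin_induction with
  | mem b hb =>
    refine NonUnitalAlgebra.subset_adjoin R ⟨star_mem_standardGens hb.1, ?_⟩
    rw [star_star]; exact hb.2.symm
  | add a b _ _ ha hb => rw [star_add]; exact add_mem ha hb
  | zero => rw [star_zero]; exact zero_mem _
  | mul a b _ _ ha hb => rw [star_mul]; exact mul_mem hb ha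
  | smul t a _ ha => rw [star_smul']; exact SMulMemClass.smul_mem t ha

lemma mul_star_mem_commutativeCore {g : E.LeavittPathAlgebra R} (hg : g ∈ standardGens E R) :
    g * star g ∈ commutativeCore E R :=
  NonUnitalAlgebra.subset_adjoin R (mul_star_mem_normalGens hg)

lemma star_mul_mem_commutativeCore {g : E.LeavittPathAlgebra R} (hg : g ∈ standardGens E R) :
    star g * g ∈ commutativeCore E R := by
  have := mul_star_mem_commutativeCore (star_mem_standardGens hg)
  rwa [star_star] at this

/-! ### The projection onto the commutative core -/

/-- The linear map `F` fixes the monomials `α β*` for normal pairs and annihilates the others. -/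
structure IsCoreProjection (F : E.LeavittPathAlgebra R →ₗ[R] E.LeavittPathAlgebra R) : Prop where
  normal : ∀ {x l y m}, E.IsNormalPair x l y m →
    F (walkElem E R x l * star (walkElem E R y m)) = walkElem E R x l * star (walkElem E R y m)
  not_normal : ∀ {x l y m}, E.IsWalkFrom x l → E.IsWalkFrom y m → E.endFrom x l = E.endFrom y m →
    ¬ E.IsNormalPair x l y m → F (walkElem E R x l * star (walkElem E R y m)) = 0

variable (E R) in
-- By `concat_iff`, all terms of `∑ αe (βe)*` are normal pairs if `(α, β)` is, and none is
-- otherwise.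
lemma exists_isCoreProjection :
    ∃ F : E.LeavittPathAlgebra R →ₗ[R] E.LeavittPathAlgebra R, IsCoreProjection F := by
  classical
  obtain ⟨F, hF⟩ := exists_linearMap (E := E) (R := R) (A := E.LeavittPathAlgebra R)
    (fun x l y m => if E.IsNormalPair x l y m then
      walkElem E R x l * star (walkElem E R y m) else 0)
    (by
      intro x l y m hfin hne
      have : ∀ e ∈ hfin.toFinset, E.IsNormalPair x (l ++ [e]) y (m ++ [e]) ↔
          E.IsNormalPair x l y m := fun e he => IsNormalPair.concat_iff (by simpa using he)
      split_ifs with h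
      · rw [monomial_eq_sum h.4 hfin hne]
        exact Finset.sum_congr rfl fun e he => (if_pos ((this e he).2 h)).symm
      · exact (Finset.sum_eq_zero fun e he => if_neg (mt (this e he).1 h)).symm)
    (fun x l y m hm => if_neg fun h => hm h.3)
  refine ⟨F, fun {x l y m} h => ?_, fun {x l y m} hl hm he h => ?_⟩
  · rw [hF x l y m h.2 h.3 h.4, if_pos h]
  · rw [hF x l y m hl hm he, if_neg h]

namespace IsCoreProjection

variable {F : E.LeavittPathAlgebra R →ₗ[R] E.LeavittPathAlgebra R} (hF : IsCoreProjection F)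

include hF

/-- The dichotomy sidesteps the question whether a pair that is not normal can represent a normal
element, so it does not rely on vertices being nonzero. -/
lemma eq_self_or_zero {g : E.LeavittPathAlgebra R} (hg : g ∈ standardGens E R) :
    g ∈ normalGens E R ∧ F g = g ∨ F g = 0 := by
  obtain ⟨x, l, y, m, hl, hm, h, rfl⟩ := mem_standardGens_iff.1 hg
  by_cases H : E.IsNormalPair x l y m
  · exact .inl ⟨mem_normalGens_of_isNormalPair H, hF.normal H⟩
  · exact .inr (hF.not_normal hl hm h H)

lemma mem_core (a : E.LeavittPathAlgebra R) : F a ∈ commutativeCore E R := by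
  have ha := mem_span_standardGens a
  induction ha using Submodule.span_induction with
  | mem a ha =>
    rcases hF.eq_self_or_zero ha with ⟨h, h'⟩ | h
    · rw [h']; exact NonUnitalAlgebra.subset_adjoin R h
    · rw [h]; exact zero_mem _
  | zero => rw [map_zero]; exact zero_mem _
  | add a b _ _ ha hb => rw [map_add]; exact add_mem ha hb
  | smul t a _ ha => rw [map_smul]; exact SMulMemClass.smul_mem t ha

lemma map_star (a : E.LeavittPathAlgebra R) : F (star a) = star (F a) := by
  have ha := mem_span_standardGens a
  induction ha using Submodule.span_induction with
  | mem a ha =>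
    obtain ⟨x, l, y, m, hl, hm, h, rfl⟩ := mem_standardGens_iff.1 ha
    rw [star_mul, star_star]
    by_cases H : E.IsNormalPair x l y m
    · rw [hF.normal H, hF.normal H.symm, star_mul, star_star]
    · rw [hF.not_normal hl hm h H, hF.not_normal hm hl h.symm (mt IsNormalPair.symm H), star_zero]
  | zero => rw [map_zero, star_zero, map_zero]
  | add a b _ _ ha hb => rw [map_add, star_add, star_add, map_add, ha, hb]
  | smul t a _ ha => rw [map_smul, star_smul', star_smul', map_smul, ha]

/-- Let `(α, β)` be normal. A nonzero product with `γ δ*` is `(αt) δ*` when `γ = βt`, or `α (δt)*`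
when `β = γt`. In the first case `αt` is equivalent to `γ`; in the second `α` is equivalent to `γt`.
Either way the resulting pair is normal exactly when `(γ, δ)` is. -/
lemma map_monomial_mul {x y y' z : V} {l m m' k : List Ed} (h : E.IsNormalPair x l y m)
    (hm' : E.IsWalkFrom y' m') (hk : E.IsWalkFrom z k) (h' : E.endFrom y' m' = E.endFrom z k) :
    F (walkElem E R x l * star (walkElem E R y m) *
      (walkElem E R y' m' * star (walkElem E R z k))) =
        walkElem E R x l * star (walkElem E R y m) *
          F (walkElem E R y' m' * star (walkElem E R z k)) := by
  by_cases hN : E.IsNormalPair y' m' z k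
  · rw [hF.normal hN]
    by_cases H : y = y' → ¬ (m <+: m' ∨ m' <+: m)
    · rw [monomial_mul_eq_zero h.3 hm' H, map_zero]
    push Not at H
    obtain ⟨rfl, ⟨t, rfl⟩ | ⟨t, rfl⟩⟩ := H
    · rw [monomial_mul_of_prefix hm' h.4]
      exact hF.normal (((IsNormalPair.append_iff (isWalkFrom_append.1 hm').2).2 h).trans hN)
    · rw [monomial_mul_of_prefix' h.3 h'.symm]
      refine hF.normal (h.trans ((IsNormalPair.append_iff ?_).2 hN))
      rw [← h']; exact (isWalkFrom_append.1 h.3).2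
  · rw [hF.not_normal hm' hk h' hN, mul_zero]
    by_cases H : y = y' → ¬ (m <+: m' ∨ m' <+: m)
    · rw [monomial_mul_eq_zero h.3 hm' H, map_zero]
    push Not at H
    obtain ⟨rfl, ⟨t, rfl⟩ | ⟨t, rfl⟩⟩ := H
    · rw [monomial_mul_of_prefix hm' h.4]
      have ht := (isWalkFrom_append.1 hm').2
      refine hF.not_normal (isWalkFrom_append.2 ⟨h.2, h.4 ▸ ht⟩) hk ?_ fun H => hN ?_
      · rw [endFrom_append, h.4, ← endFrom_append, h']
      · exact ((IsNormalPair.append_iff ht).2 h).symm.trans H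
    · rw [monomial_mul_of_prefix' h.3 h'.symm]
      have ht := (isWalkFrom_append.1 h.3).2
      rw [h'] at ht
      refine hF.not_normal h.2 (isWalkFrom_append.2 ⟨hk, ht⟩) ?_ fun H => hN ?_
      · rw [h.4, endFrom_append, endFrom_append, h']
      · exact (IsNormalPair.append_iff ht).1 (h.symm.trans H)

variable [Nontrivial R]

lemma map_mul {b : E.LeavittPathAlgebra R} (hb : b ∈ commutativeCore E R)
    (a : E.LeavittPathAlgebra R) : F (b * a) = b * F a := by
  induction hb using NonUnitalAlgebra.adjoin_induction generalizing a with
  | mem b hb =>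
    have ha := mem_span_standardGens a
    induction ha using Submodule.span_induction with
    | mem a ha =>
      obtain ⟨x, l, y, m, h, rfl⟩ := mem_normalGens_iff.1 hb
      obtain ⟨x', l', y', m', hl, hm, he, rfl⟩ := mem_standardGens_iff.1 ha
      exact hF.map_monomial_mul h hl hm he
    | zero => rw [mul_zero, map_zero, mul_zero]
    | add a a' _ _ h h' => rw [mul_add, map_add, h, h', map_add, mul_add]
    | smul t a _ h => rw [mul_smul_comm, map_smul, h, map_smul, mul_smul_comm]
  | add b b' _ _ h h' => rw [add_mul, map_add, h, h', add_mul]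
  | zero => rw [zero_mul, map_zero, zero_mul]
  | mul b b' _ _ h h' => rw [mul_assoc, h, h', mul_assoc]
  | smul t b _ h => rw [smul_mul_assoc, map_smul, h, smul_mul_assoc]

lemma map_mul' {b : E.LeavittPathAlgebra R} (hb : b ∈ commutativeCore E R)
    (a : E.LeavittPathAlgebra R) : F (a * b) = F a * b := by
  apply star_injective
  rw [← hF.map_star, star_mul, hF.map_mul (star_mem_commutativeCore hb), hF.map_star, star_mul]

lemma eq_self {b : E.LeavittPathAlgebra R} (hb : b ∈ commutativeCore E R) : F b = b := by
  induction hb using NonUnitalAlgebra.adjoin_induction with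
  | mem b hb =>
    obtain ⟨x, l, y, m, h, rfl⟩ := mem_normalGens_iff.1 hb
    exact hF.normal h
  | add a b _ _ ha hb => rw [map_add, ha, hb]
  | zero => exact map_zero F
  | mul a b ha _ _ hb => rw [hF.map_mul ha, hb]
  | smul t a _ ha => rw [map_smul, ha]

/-- The projections `g g*` commute with the commutative core. -/
lemma commute_range_projection {g u : E.LeavittPathAlgebra R} (hg : g ∈ standardGens E R)
    (hu : u ∈ commutativeCore E R) : g * star g * u = u * (g * star g) := by
  induction hu using NonUnitalAlgebra.adjoin_induction with
  | mem u hu =>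
    have he := mul_star_mem_commutativeCore hg
    have hS := (mul_star_mem_normalGens hg).1
    have hcomm := range_projections_commute hg hu.1
    have hee : g * star g * (g * star g) = g * star g := by
      rw [← mul_assoc, mul_star_mul_self hg]
    have hes : star (g * star g) = g * star g := by rw [star_mul, star_star]
    generalize g * star g = e at *
    -- Since `F` fixes `eu`, this element of `G_E ∪ {0}` is zero or normal.
    have hFu : F (e * u) = e * u := by
      rw [hF.map_mul he, hF.eq_self (NonUnitalAlgebra.subset_adjoin R hu)]
    have hn : e * u * star (e * u) = star (e * u) * (e * u) := by
      rcases mul_mem_standardGens hS hu.1 with h | h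
      · rw [h, zero_mul, mul_zero]
      · rcases hF.eq_self_or_zero h with h' | h'
        · exact h'.1.2
        · rw [← hFu, h', zero_mul, mul_zero]
    -- This is the normality of `eu`, written out using that `e` commutes with `u u*`.
    have hn' : e * (u * star u) = star u * e * u := by
      calc e * (u * star u) = e * (u * star u) * e := by
            rw [mul_assoc, ← hcomm, ← mul_assoc e e, hee]
        _ = e * u * star (e * u) := by rw [star_mul, hes]; simp only [mul_assoc]
        _ = star u * (e * e) * u := by rw [hn, star_mul, hes]; simp only [mul_assoc]
        _ = star u * e * u := by rw [hee]
    -- Insert `u = u u* u`, move `e` past `u u*`, apply the previous identity to `u* e u`, and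
    -- finish with `u u* = u* u`.
    calc e * u = e * (u * star u * u) := by rw [mul_star_mul_self hu.1]
      _ = (u * star u) * e * u := by rw [← mul_assoc, hcomm]
      _ = u * (e * (u * star u)) := by rw [hn']; simp only [mul_assoc]
      _ = u * (u * star u) * e := by rw [hcomm]; simp only [mul_assoc]
      _ = u * e := by rw [hu.2, ← mul_assoc, mul_star_mul_self hu.1]
  | add a b _ _ ha hb => rw [mul_add, ha, hb, add_mul]
  | zero => rw [mul_zero, zero_mul]
  | mul a b _ _ ha hb => rw [← mul_assoc, ha, mul_assoc, hb, mul_assoc]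
  | smul t a _ ha => rw [mul_smul_comm, ha, smul_mul_assoc]

end IsCoreProjection

/-! ### Positivity -/

/-- With respect to the `M_R(E)`-valued inner product `F (a* b)`, the map `P` is an orthogonal
projection which multiplies each `g ∈ G_E` by a central projection of `M_R(E)` below `g* g`. -/
structure IsFrameProjection (F P : E.LeavittPathAlgebra R →ₗ[R] E.LeavittPathAlgebra R) :
    Prop where
  map_mul : ∀ a, ∀ b ∈ commutativeCore E R, P (a * b) = P a * b
  adjoint : ∀ a b, F (star a * P b) = F (star (P a) * b)
  idem : ∀ a, P (P a) = P a
  positive : ∀ a, F (star a * P a) ∈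
    positiveElements (commutativeCore E R : Set (E.LeavittPathAlgebra R))
  eq_mul : ∀ g ∈ standardGens E R, ∃ f ∈ commutativeCore E R, star f = f ∧ star g * g * f = f ∧
    (∀ u ∈ commutativeCore E R, f * u = u * f) ∧ P g = g * f

lemma IsFrameProjection.zero (F : E.LeavittPathAlgebra R →ₗ[R] E.LeavittPathAlgebra R) :
    IsFrameProjection F 0 where
  map_mul a b _ := by simp
  adjoint a b := by simp
  idem a := by simp
  positive a := by
    rw [LinearMap.zero_apply, mul_zero, map_zero]
    exact AddSubmonoid.zero_mem _
  eq_mul g _ := ⟨0, zero_mem _, by simp⟩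

variable [Nontrivial R] {F P : E.LeavittPathAlgebra R →ₗ[R] E.LeavittPathAlgebra R}

/-- One Gram–Schmidt step. Write `P g = g f` and put `d = g* g - f`, `n = g - P g = g d`. Then `n* n
= d` is a projection and `F(n* P a) = 0` for all `a`, so `P' = P + n F(n* ·)` is again an orthogonal
projection. It fixes `g` because `n F(n* g) = n d = n`, and it keeps fixed whatever `P` fixes. The
new contribution to `F(a* P' a)` is `F(n* a)* F(n* a)`. -/
lemma IsFrameProjection.exists_extension (hF : IsCoreProjection F) (hP : IsFrameProjection F P)
    {g : E.LeavittPathAlgebra R} (hg : g ∈ standardGens E R) :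
    ∃ P' : E.LeavittPathAlgebra R →ₗ[R] E.LeavittPathAlgebra R, IsFrameProjection F P' ∧
      P' g = g ∧ ∀ t, P t = t → P' t = t := by
  obtain ⟨f, hf, hfs, hqf, hfc, hPg⟩ := hP.eq_mul g hg
  have hq := star_mul_mem_commutativeCore hg
  have hqc : ∀ u ∈ commutativeCore E R, star g * g * u = u * (star g * g) := fun u hu => by
    simpa only [star_star] using hF.commute_range_projection (star_mem_standardGens hg) hu
  have hgq : g * (star g * g) = g := by rw [← mul_assoc, mul_star_mul_self hg]
  have hqq : star g * g * (star g * g) = star g * g := by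
    rw [mul_assoc, hgq]
  -- Idempotence of `P` at `g` gives `g f f = g f`; multiply by `g*` and use `g* g f = f`.
  have hff : f * f = f := by
    have h1 : g * (f * f) = g * f := by
      have h := hP.idem g
      rw [hPg, hP.map_mul g f hf, hPg, mul_assoc] at h
      exact h
    have h2 := congrArg (star g * ·) h1
    simp only [← mul_assoc] at h2
    rwa [hqf] at h2
  have hfq : f * (star g * g) = f := by rw [hfc _ hq, hqf]
  obtain ⟨d, hd⟩ : ∃ d, d = star g * g - f := ⟨_, rfl⟩
  have hdM : d ∈ commutativeCore E R := hd ▸ sub_mem hq hf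
  have hds : star d = d := by rw [hd, star_sub, star_mul, star_star, hfs]
  have hdd : d * d = d := by
    rw [hd, mul_sub, sub_mul, sub_mul, hqq, hfq, hqf, hff]; abel
  have hdc : ∀ u ∈ commutativeCore E R, d * u = u * d := fun u hu => by
    rw [hd, sub_mul, hqc u hu, hfc u hu, mul_sub]
  have hqd : star g * g * d = d := by rw [hd, mul_sub, hqq, hqf]
  have hdq : d * (star g * g) = d := by rw [hdc _ hq, hqd]
  have hgd : g * d = g - P g := by rw [hd, mul_sub, hgq, hPg]
  obtain ⟨n, hn⟩ : ∃ n, n = g * d := ⟨_, rfl⟩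
  have hPn : P n = 0 := by rw [hn, hgd, map_sub, hP.idem, sub_self]
  have hFP : ∀ a, F (star n * P a) = 0 := fun a => by
    rw [hP.adjoint, hPn, star_zero, zero_mul, map_zero]
  have hng : star n * g = d := by rw [hn, star_mul, hds, mul_assoc, hdq]
  have hnn : star n * n = d := by
    nth_rw 2 [hn]
    rw [← mul_assoc, hng, hdd]
  have hnd : n * d = n := by rw [hn, mul_assoc, hdd]
  have hFd : F d = d := hF.eq_self hdM
  let P' : E.LeavittPathAlgebra R →ₗ[R] E.LeavittPathAlgebra R :=
    P + LinearMap.mulLeft R n ∘ₗ F ∘ₗ LinearMap.mulLeft R (star n)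
  have hP' : ∀ a, P' a = P a + n * F (star n * a) := fun a => rfl
  have hstar : ∀ a, star (F (star n * a)) = F (star a * n) := fun a => by
    rw [← hF.map_star, star_mul, star_star]
  refine ⟨P', ⟨fun a b hb => ?_, fun a b => ?_, fun a => ?_, fun a => ?_, fun h hh => ?_⟩, ?_, ?_⟩
  · rw [hP', hP', hP.map_mul a b hb, ← mul_assoc (star n), hF.map_mul' hb, add_mul, mul_assoc]
  · rw [hP', hP', mul_add, map_add, hP.adjoint, ← mul_assoc, hF.map_mul' (hF.mem_core _), star_add,
      add_mul, map_add, star_mul, hstar, mul_assoc, hF.map_mul (hF.mem_core _)]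
  · have hFF : ∀ c, F (star n * (n * F c)) = d * F c := fun c => by
      rw [← mul_assoc, hnn, hF.map_mul hdM, hF.eq_self (hF.mem_core c)]
    rw [hP', hP', map_add, hP.idem, hP.map_mul n _ (hF.mem_core _), hPn, zero_mul, add_zero,
      mul_add, map_add, hFP, zero_add, hFF, ← mul_assoc, hnd]
  · rw [hP', mul_add, map_add, ← mul_assoc, hF.map_mul' (hF.mem_core _), ← hstar]
    exact AddSubmonoid.add_mem _ (hP.positive a)
      (AddSubmonoid.subset_closure ⟨_, hF.mem_core _, rfl⟩)
  · obtain ⟨f', hf', hfs', hqf', hfc', hPh⟩ := hP.eq_mul h hh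
    have hFn : F (star n * h) = d * F (star g * h) := by
      rw [hn, star_mul, hds, mul_assoc, hF.map_mul hdM]
    have hnF : n * F (star n * h) = g * F (star g * h) * d := by
      rw [hFn, ← mul_assoc, hnd, hn, mul_assoc, hdc _ (hF.mem_core _), mul_assoc]
    rw [hP', hnF, hPh]
    -- If `F(g* h) ≠ 0`, it equals `u = g* h`, and `g u = g g* h h* h = h h* g g* h = h u* u`. The
    -- new term is thus `h (u* u d)`, which keeps `P' h` of the form `h` times a suitable element of
    -- the core.
    by_cases h0 : F (star g * h) = 0
    · exact ⟨f', hf', hfs', hqf', hfc', by rw [h0, mul_zero, zero_mul, add_zero]⟩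
    have hu : star g * h ∈ standardGens E R := by
      refine (mul_mem_standardGens (star_mem_standardGens hg) hh).resolve_left fun h1 => h0 ?_
      rw [h1, map_zero]
    have hFu : F (star g * h) = star g * h := ((hF.eq_self_or_zero hu).resolve_right h0).2
    have hv := star_mul_mem_commutativeCore hu
    have hvc : ∀ u ∈ commutativeCore E R, star (star g * h) * (star g * h) * u =
        u * (star (star g * h) * (star g * h)) := fun u hu' => by
      simpa only [star_star] using hF.commute_range_projection (star_mem_standardGens hu) hu'
    refine ⟨f' + star (star g * h) * (star g * h) * d, add_mem hf' (mul_mem hv hdM), ?_, ?_, ?_, ?_⟩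
    · rw [star_add, hfs', star_mul, hds, star_mul (star (star g * h)), star_star, hdc _ hv]
    · rw [mul_add, hqf', ← mul_assoc]
      congr 2
      rw [star_mul, star_star]
      calc star h * h * (star h * g * (star g * h))
          = star h * h * star h * g * (star g * h) := by simp only [mul_assoc]
        _ = star h * g * (star g * h) := by rw [star_mul_mul_star hh]
    · intro u hu'
      rw [add_mul, mul_add, hfc' u hu', mul_assoc, hdc u hu', ← mul_assoc, hvc u hu', mul_assoc]
    · rw [mul_add, hFu, ← mul_assoc h]
      congr 2
      calc g * (star g * h) = g * star g * (h * star h) * h := by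
            rw [mul_assoc _ _ h, mul_star_mul_self hh, mul_assoc]
        _ = h * (star (star g * h) * (star g * h)) := by
            rw [range_projections_commute hg hh, star_mul, star_star]
            simp only [mul_assoc]
  · rw [hP', hng, hFd, hnd, hn, hgd]; abel
  · intro t ht
    rw [hP', ht]
    nth_rw 2 [← ht]
    rw [hFP, mul_zero, add_zero]

lemma exists_isFrameProjection (hF : IsCoreProjection F)
    {T : Set (E.LeavittPathAlgebra R)} (hfin : T.Finite) (hT : T ⊆ standardGens E R) :
    ∃ P, IsFrameProjection F P ∧ ∀ g ∈ T, P g = g := by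
  induction T, hfin using Set.Finite.induction_on with
  | empty => exact ⟨0, .zero F, fun g hg => hg.elim⟩
  | insert _ _ ih =>
    obtain ⟨P, hP, hPT⟩ := ih fun g hg => hT (Set.mem_insert_of_mem _ hg)
    obtain ⟨P', hP', h1, h2⟩ := hP.exists_extension hF (hT (Set.mem_insert _ _))
    refine ⟨P', hP', fun g hg => ?_⟩
    rcases hg with rfl | hg
    · exact h1
    · exact h2 g (hPT g hg)

/-- An element `y` is a combination of finitely many members of `G_E`, and a frame projection `P`
fixing those fixes `y` by linearity, whatever the coefficients. Hence `F(y* y) = F(y* P y)`, which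
is positive by construction. -/
lemma IsCoreProjection.positive (hF : IsCoreProjection F) {a : E.LeavittPathAlgebra R}
    (ha : a ∈ positiveElements (Set.univ : Set (E.LeavittPathAlgebra R))) :
    F a ∈ positiveElements (commutativeCore E R : Set (E.LeavittPathAlgebra R)) := by
  change a ∈ AddSubmonoid.closure _ at ha
  induction ha using AddSubmonoid.closure_induction with
  | mem a ha =>
    obtain ⟨y, -, rfl⟩ := ha
    obtain ⟨T, hT, hy⟩ := Submodule.mem_span_finite_of_mem_span (mem_span_standardGens y)
    obtain ⟨P, hP, hPT⟩ := exists_isFrameProjection hF T.finite_toSet hT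
    have hPy : P y = y := by
      induction hy using Submodule.span_induction with
      | mem g hg => exact hPT g hg
      | zero => exact map_zero P
      | add a b _ _ ha hb => rw [map_add, ha, hb]
      | smul t a _ ha => rw [map_smul, ha]
    nth_rw 2 [← hPy]
    exact hP.positive y
  | zero => rw [map_zero]; exact AddSubmonoid.zero_mem _
  | add a b _ _ ha hb => rw [map_add]; exact AddSubmonoid.add_mem _ ha hb

end LeavittPathAlgebra

end DirectedGraph

namespace DirectedGraph

variable {V : Type u} {Ed : Type v} {E : DirectedGraph V Ed}

/-! ### Extensions of trails by walks -/

/-- The edge of a trail at a given position, if there is one. -/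
def Trail.edge? : E.Trail → ℕ → Option Ed
  | .finite p _, n => p.edges[n]?
  | .infinite f _, n => some (f n)

lemma Trail.edge?_cons_zero (e : Ed) (τ : E.Trail) (h : E.r e = τ.source) :
    (τ.cons e h).edge? 0 = some e := by
  cases τ <;> rfl

lemma Trail.edge?_cons_succ (e : Ed) (τ : E.Trail) (h : E.r e = τ.source) (n : ℕ) :
    (τ.cons e h).edge? (n + 1) = τ.edge? n := by
  cases τ <;> rfl

lemma Trail.ext_edge? {τ κ : E.Trail} (hs : τ.source = κ.source)
    (h : ∀ n, τ.edge? n = κ.edge? n) : τ = κ := by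
  cases τ with
  | finite p hp =>
    cases κ with
    | finite q hq =>
      have : p = q := Path.ext hs (List.ext_getElem? h)
      subst this
      rfl
    | infinite g hg => simpa [edge?] using h p.edges.length
  | infinite f hf =>
    cases κ with
    | finite q hq => simpa [edge?] using h q.edges.length
    | infinite g hg =>
      have : f = g := funext fun n => Option.some_injective _ (h n)
      subst this
      rfl

lemma Trail.edge?_of_isSink {τ : E.Trail} (h : E.IsSink τ.source) (n : ℕ) : τ.edge? n = none := by
  cases τ with
  | finite p hp =>
    obtain ⟨x, l, hl⟩ := p
    cases l with
    | nil => rfl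
    | cons e l => exact absurd hl.1 (h e)
  | infinite f hf => exact absurd rfl (h (f 0))

/-- At each vertex met from a linear one there is at most one edge to follow, so a trail is
determined edge by edge; it ends precisely if it meets a sink. -/
lemma Trail.eq_of_isLinearAt {τ κ : E.Trail} (h : E.IsLinearAt τ.source)
    (hs : τ.source = κ.source) : τ = κ := by
  refine Trail.ext_edge? hs fun n => ?_
  induction n generalizing τ κ with
  | zero =>
    by_cases hsink : E.IsSink τ.source
    · rw [edge?_of_isSink hsink, edge?_of_isSink (hs ▸ hsink)]
    · obtain ⟨e, τ, hτ, rfl⟩ := τ.exists_cons hsink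
      obtain ⟨f, κ, hκ, rfl⟩ := κ.exists_cons (hs ▸ hsink)
      rw [source_cons, source_cons] at hs
      rw [source_cons] at h
      have := h [e] [f] (isWalkFrom_singleton.2 rfl) (isWalkFrom_singleton.2 hs.symm)
      rw [edge?_cons_zero, edge?_cons_zero]
      simpa [eq_comm] using this
  | succ n ih =>
    by_cases hsink : E.IsSink τ.source
    · rw [edge?_of_isSink hsink, edge?_of_isSink (hs ▸ hsink)]
    · obtain ⟨e, τ, hτ, rfl⟩ := τ.exists_cons hsink
      obtain ⟨f, κ, hκ, rfl⟩ := κ.exists_cons (hs ▸ hsink)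
      rw [source_cons, source_cons] at hs
      rw [source_cons] at h
      have := h [e] [f] (isWalkFrom_singleton.2 rfl) (isWalkFrom_singleton.2 hs.symm)
      obtain rfl : e = f := by simpa [eq_comm] using this
      rw [edge?_cons_succ, edge?_cons_succ]
      refine ih ?_ (hτ.symm.trans hκ)
      rw [← hτ]
      exact h.endFrom (l := [e]) (isWalkFrom_singleton.2 rfl)

/-- `σ` is the trail `l τ`. -/
inductive IsExtension : List Ed → E.EssTrail → E.EssTrail → Prop
  | nil (τ : E.EssTrail) : IsExtension [] τ τ
  | cons {l : List Ed} {τ σ : E.EssTrail} (e : Ed) (h : E.r e = σ.source)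
      (hσ : IsExtension l τ σ) : IsExtension (e :: l) τ (σ.cons e h)

namespace IsExtension

variable {l m : List Ed} {τ τ' σ σ' : E.EssTrail}

lemma unique (h : IsExtension l τ σ) (h' : IsExtension l τ σ') : σ = σ' := by
  induction h generalizing σ' with
  | nil => cases h'; rfl
  | cons e he _ ih =>
    cases h' with
    | cons _ he' h' =>
      obtain rfl := ih h'
      rfl

lemma injective (h : IsExtension l τ σ) (h' : IsExtension l τ' σ) : τ = τ' := by
  induction l generalizing σ with
  | nil => cases h; cases h'; rfl
  | cons e l ih =>
    generalize hρ : σ = ρ at h'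
    cases h with
    | cons _ he h =>
      cases h' with
      | cons _ he' h' =>
        obtain ⟨-, rfl⟩ := EssTrail.cons_inj _ _ hρ
        exact ih h h'

lemma exists_of_append (h : IsExtension (l ++ m) τ σ) :
    ∃ κ, IsExtension m τ κ ∧ IsExtension l κ σ := by
  induction l generalizing σ with
  | nil => exact ⟨σ, h, .nil σ⟩
  | cons e l ih =>
    cases h with
    | cons _ he h =>
      obtain ⟨κ, h1, h2⟩ := ih h
      exact ⟨κ, h1, h2.cons e he⟩

lemma prefix_or_prefix (h : IsExtension l τ σ) (h' : IsExtension m τ' σ) :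
    l <+: m ∨ m <+: l := by
  induction l generalizing m σ with
  | nil => exact .inl List.nil_prefix
  | cons e l ih =>
    cases m with
    | nil => exact .inr List.nil_prefix
    | cons f m =>
      generalize hρ : σ = ρ at h'
      cases h with
      | cons _ he h =>
        cases h' with
        | cons _ he' h' =>
          obtain ⟨rfl, rfl⟩ := EssTrail.cons_inj _ _ hρ
          simpa only [List.prefix_cons_inj] using ih h h'

lemma source_eq (h : IsExtension l τ σ) : E.endFrom σ.source l = τ.source := by
  induction h with
  | nil => rfl
  | cons e he _ ih => rw [endFrom, he, ih]

lemma edge?_add_length (h : IsExtension l τ σ) (n : ℕ) :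
    σ.1.edge? (n + l.length) = τ.1.edge? n := by
  induction h with
  | nil => rfl
  | cons e he _ ih =>
    rw [List.length_cons, ← add_assoc]
    exact (Trail.edge?_cons_succ _ _ he _).trans ih

/-- An essentially aperiodic trail `τ` with `τ = c τ`, for some nonempty `c`, meets no branching. -/
lemma isLinearAt (h : IsExtension l τ τ) (hl : l ≠ []) : E.IsLinearAt τ.source := by
  have hper := h.edge?_add_length
  have hpos : 0 < l.length := List.length_pos_iff.2 hl
  obtain ⟨_ | ⟨f, hf⟩, hτ⟩ := τ
  · rename_i p hp
    exfalso
    -- Periodicity transports a position beyond the end of a finite trail back to position `0`, so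
    -- the trail would have no first edge, although it begins with the first edge of `l`.
    have h0 : ∀ n, p.edges[n * l.length]? = p.edges[0]? := by
      intro n
      induction n with
      | zero => rw [zero_mul]
      | succ n ih => rw [Nat.succ_mul]; exact (hper _).trans ih
    have h1 : p.edges[0]? = none := by
      rw [← h0 p.edges.length]
      exact List.getElem?_eq_none (Nat.le_mul_of_pos_right _ hpos)
    have h2 : ∀ σ : E.EssTrail, IsExtension l σ σ → σ.1.edge? 0 ≠ none := by
      intro σ hσ
      generalize hρ : σ = ρ at hσ
      cases hσ with
      | nil => exact absurd rfl hl
      | cons e he _ =>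
        exact fun H => Option.some_ne_none _ ((Trail.edge?_cons_zero _ _ he).symm.trans H)
    exact h2 _ h h1
  -- The sequence repeats from index `0` on, so essential aperiodicity makes each `f i` the only
  -- edge leaving its source. The period used need not be minimal.
  · have hfp : IsPeriodicAt f 0 l.length := ⟨hpos, fun n _ => Option.some_injective _ (hper n)⟩
    have hdet : ∀ i e, E.s e = E.s (f i) → e = f i := fun i =>
      (isEssentiallyAperiodic_infinite f hf).1 hτ 0 _ hfp i (Nat.zero_le i)
    have key : ∀ (p q : List Ed) (i : ℕ), E.IsWalkFrom (E.s (f i)) p →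
        E.IsWalkFrom (E.s (f i)) q → p <+: q ∨ q <+: p := by
      intro p
      induction p with
      | nil => exact fun _ _ _ _ => .inl List.nil_prefix
      | cons e p ih =>
        intro q i hp hq
        cases q with
        | nil => exact .inr List.nil_prefix
        | cons e' q =>
          obtain ⟨he, hp⟩ := hp
          obtain ⟨he', hq⟩ := hq
          obtain rfl := hdet i e he
          obtain rfl := hdet i e' he'
          rw [hf] at hp hq
          simpa only [List.prefix_cons_inj] using ih q (i + 1) hp hq
    exact fun p q => key p q 0

end IsExtension

namespace LeavittPathAlgebra

/-! ### The essentially aperiodic representation on monomials -/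

variable {R : Type w} [CommRing R]

lemma aperiodicRep_gen (g : Gen V Ed) :
    (E.aperiodicRep R (gen E R g) : Module.End R (E.TrailModule R)) = E.genOp R g :=
  congrArg Subtype.val (lift_gen _ genOp_rel' g)

lemma aperiodicRep_mul_apply (a b : E.LeavittPathAlgebra R) (m : E.TrailModule R) :
    (E.aperiodicRep R (a * b) : Module.End R (E.TrailModule R)) m =
      (E.aperiodicRep R a : Module.End R (E.TrailModule R))
        ((E.aperiodicRep R b : Module.End R (E.TrailModule R)) m) := by
  rw [_root_.map_mul]; rfl

lemma exists_aperiodicRep_walkElem {x : V} {l : List Ed} (hl : E.IsWalkFrom x l) {τ : E.EssTrail}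
    (hτ : τ.source = E.endFrom x l) :
    ∃ σ : E.EssTrail, IsExtension l τ σ ∧ σ.source = x ∧ ∀ n,
      (E.aperiodicRep R (walkElem E R x l) : Module.End R (E.TrailModule R)) (xi R τ n) =
        xi R σ (n + l.length) := by
  induction l generalizing x with
  | nil =>
    refine ⟨τ, .nil τ, hτ, fun n => ?_⟩
    rw [walkElem, aperiodicRep_gen, genOp]
    have hτ : τ.source = x := hτ
    rw [← hτ, vertOp_xi_same]; simp
  | cons e l ih =>
    obtain ⟨rfl, hl⟩ := hl
    obtain ⟨σ, hσ, hs, h⟩ := ih hl hτ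
    refine ⟨σ.cons e hs.symm, hσ.cons e hs.symm, EssTrail.source_cons _ _ _, fun n => ?_⟩
    rw [walkElem, aperiodicRep_mul_apply, h, aperiodicRep_gen, genOp, edgeOp_xi hs.symm]
    rw [List.length_cons, Nat.cast_succ, add_assoc]

lemma aperiodicRep_star_walkElem {y : V} {m : List Ed} (hm : E.IsWalkFrom y m) (σ : E.EssTrail) :
    (∃ τ : E.EssTrail, IsExtension m τ σ ∧ σ.source = y ∧ ∀ n,
      (E.aperiodicRep R (star (walkElem E R y m)) : Module.End R (E.TrailModule R)) (xi R σ n) =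
        xi R τ (n - m.length)) ∨
    ∀ n, (E.aperiodicRep R (star (walkElem E R y m)) : Module.End R (E.TrailModule R))
      (xi R σ n) = 0 := by
  induction m generalizing y σ with
  | nil =>
    simp only [walkElem, star_vert, aperiodicRep_gen, genOp]
    by_cases h : σ.source = y
    · refine .inl ⟨σ, .nil σ, h, fun n => ?_⟩
      rw [← h, vertOp_xi_same]; simp
    · exact .inr fun n => vertOp_xi_ne h n
  | cons e m ih =>
    obtain ⟨rfl, hm⟩ := hm
    simp only [walkElem, star_mul, star_edge, aperiodicRep_mul_apply]
    simp only [aperiodicRep_gen, genOp]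
    by_cases h : ∃ (β : E.EssTrail) (hβ : E.r e = β.source), σ = β.cons e hβ
    · obtain ⟨β, hβ, rfl⟩ := h
      simp only [ghostOp_xi_cons]
      rcases ih hm β with ⟨τ, hτ, -, h⟩ | h
      · refine .inl ⟨τ, hτ.cons e hβ, EssTrail.source_cons _ _ _, fun n => ?_⟩
        rw [h, List.length_cons, Nat.cast_succ]
        congr 1; ring
      · exact .inr fun n => h _
    · exact .inr fun n => by rw [ghostOp_xi_ne h, map_zero]

/-- The operator of `α β*` removes `β` from the front of a trail and puts `α` there. Which
alternative occurs depends on the trail only, not on the degree `n`. -/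
lemma aperiodicRep_monomial {x y : V} {l m : List Ed} (hl : E.IsWalkFrom x l)
    (hm : E.IsWalkFrom y m) (h : E.endFrom x l = E.endFrom y m) (σ : E.EssTrail) :
    (∃ τ σ' : E.EssTrail, IsExtension m τ σ ∧ σ.source = y ∧ IsExtension l τ σ' ∧
      σ'.source = x ∧ ∀ n, (E.aperiodicRep R (walkElem E R x l * star (walkElem E R y m)) :
        Module.End R (E.TrailModule R)) (xi R σ n) = xi R σ' (n - m.length + l.length)) ∨
    ∀ n, (E.aperiodicRep R (walkElem E R x l * star (walkElem E R y m)) :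
        Module.End R (E.TrailModule R)) (xi R σ n) = 0 := by
  simp only [aperiodicRep_mul_apply]
  rcases aperiodicRep_star_walkElem (R := R) hm σ with ⟨τ, hτ, hs, H⟩ | H
  · have hτs : τ.source = E.endFrom x l := by rw [h, ← hs, hτ.source_eq]
    obtain ⟨σ', hσ', hs', H'⟩ := exists_aperiodicRep_walkElem (R := R) hl hτs
    exact .inl ⟨τ, σ', hτ, hs, hσ', hs', fun n => by rw [H, H']⟩
  · exact .inr fun n => by rw [H, map_zero]

/-- For a normal pair `(α, β)` one has `α τ = β τ` for each trail `τ`. -/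
lemma eq_of_isNormalPair {x y : V} {l m : List Ed} (h : E.IsNormalPair x l y m)
    {τ σ σ' : E.EssTrail} (hσ : IsExtension m τ σ) (hs : σ.source = y)
    (hσ' : IsExtension l τ σ') (hs' : σ'.source = x) : σ' = σ := by
  -- Write `m c τ = m κ`. Then `κ` and `τ` start at the same linear vertex, so `κ = τ` and the two
  -- extensions coincide.
  have key : ∀ (m c : List Ed) (σ σ' : E.EssTrail), IsExtension m τ σ →
      IsExtension (m ++ c) τ σ' → σ.source = σ'.source → E.IsLinearAt τ.source → σ = σ' := by
    intro m c σ σ' h h' hs hL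
    obtain ⟨κ, -, hκ⟩ := h'.exists_of_append
    have h1 : τ.source = κ.source := by rw [← h.source_eq, ← hκ.source_eq, hs]
    obtain rfl : τ = κ := Subtype.ext (Trail.eq_of_isLinearAt hL h1)
    exact h.unique hκ
  obtain ⟨rfl, -, -, -, rfl | ⟨hL, hlm⟩⟩ := h
  · exact hσ'.unique hσ
  rw [← hs', hσ'.source_eq] at hL
  rcases hlm with ⟨c, rfl⟩ | ⟨c, rfl⟩
  · exact key l c σ' σ hσ' hσ (hs'.trans hs.symm) hL
  · exact (key m c σ σ' hσ hσ' (hs.trans hs'.symm) hL).symm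

/-- If `α τ = β τ` for an essentially aperiodic trail `τ`, then `(α, β)` is a normal pair. -/
lemma isNormalPair_of_isExtension {x y : V} {l m : List Ed} (hl : E.IsWalkFrom x l)
    (hm : E.IsWalkFrom y m) (h : E.endFrom x l = E.endFrom y m) {τ σ : E.EssTrail}
    (hσ : IsExtension m τ σ) (hs : σ.source = y) (hσ' : IsExtension l τ σ)
    (hs' : σ.source = x) : E.IsNormalPair x l y m := by
  -- From `m τ = m c τ` one cancels `m` to get `τ = c τ`; a nonempty `c` then forces linearity.
  have key : ∀ m c : List Ed, IsExtension m τ σ → IsExtension (m ++ c) τ σ →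
      c = [] ∨ E.IsLinearAt τ.source := by
    intro m c h h'
    obtain ⟨κ, h1, hκ⟩ := h'.exists_of_append
    obtain rfl := hκ.injective h
    by_cases hc : c = []
    · exact .inl hc
    · exact .inr (h1.isLinearAt hc)
  refine ⟨hs'.symm.trans hs, hl, hm, h, ?_⟩
  rw [← hs', hσ'.source_eq]
  rcases hσ'.prefix_or_prefix hσ with ⟨c, rfl⟩ | ⟨c, rfl⟩
  · rcases key l c hσ' hσ with rfl | hL
    · exact .inl (List.append_nil l).symm
    · exact .inr ⟨hL, .inl (List.prefix_append _ _)⟩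
  · rcases key m c hσ hσ' with rfl | hL
    · exact .inl (List.append_nil m)
    · exact .inr ⟨hL, .inr (List.prefix_append _ _)⟩

/-- On a basis vector of `σ`, the expectation `E_ap` keeps only the component along `σ`, in every
degree. The image under a monomial is zero or a single basis vector, which lies on `σ` if and only
if the pair is normal; a shift of degree along a cycle does no harm. -/
lemma IsCoreProjection.aperiodicRep_comp
    {F : E.LeavittPathAlgebra R →ₗ[R] E.LeavittPathAlgebra R} (hF : IsCoreProjection F)
    (a : E.LeavittPathAlgebra R) :
    E.aperiodicRep R (F a) = E.aperiodicExp R (E.aperiodicRep R a) := by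
  have ha := mem_span_standardGens a
  induction ha using Submodule.span_induction with
  | mem a ha =>
    obtain ⟨x, l, y, m, hl, hm, h, rfl⟩ := mem_standardGens_iff.1 ha
    refine Subtype.ext (end_ext fun σ n => ?_)
    refine Eq.trans ?_ (aperiodicExpEnd_xi (E.aperiodicRep R (walkElem E R x l *
      star (walkElem E R y m)) : Module.End R (E.TrailModule R)) σ n).symm
    by_cases hN : E.IsNormalPair x l y m
    · rw [hF.normal hN]
      rcases aperiodicRep_monomial (R := R) hl hm h σ with ⟨τ, σ', h1, h2, h3, h4, H⟩ | H
      · rw [H, eq_of_isNormalPair hN h1 h2 h3 h4, trailProj_xi_same]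
      · rw [H, map_zero]
    · rw [hF.not_normal hl hm h hN, map_zero]
      change 0 = _
      rcases aperiodicRep_monomial (R := R) hl hm h σ with ⟨τ, σ', h1, h2, h3, h4, H⟩ | H
      · rw [H, trailProj_xi_ne]
        rintro rfl
        exact hN (isNormalPair_of_isExtension hl hm h h1 h2 h3 h4)
      · rw [H, map_zero]
  | zero => simp only [map_zero]
  | add a b _ _ ha hb => simp only [map_add, ha, hb]
  | smul t a _ ha => simp only [map_smul, ha]

end LeavittPathAlgebra

end DirectedGraph

/-! ### The theorem -/

open DirectedGraph.LeavittPathAlgebra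

theorem mainTheorem2 {V : Type u} {Ed : Type v} (E : DirectedGraph V Ed) (R : Type w)
    [CommRing R] :
    ∃ F : E.LeavittPathAlgebra R →ₗ[R] DirectedGraph.LeavittPathAlgebra.commutativeCore E R,
      (IsConditionalExpectation (DirectedGraph.LeavittPathAlgebra.commutativeCore E R) F ∧
        (∀ x ∈ DirectedGraph.LeavittPathAlgebra.normalGens E R,
          (F x : E.LeavittPathAlgebra R) = x) ∧
        (∀ x ∈ DirectedGraph.LeavittPathAlgebra.standardGens E R \
            DirectedGraph.LeavittPathAlgebra.normalGens E R,
          (F x : E.LeavittPathAlgebra R) = 0)) ∧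
      (∀ F' : E.LeavittPathAlgebra R →ₗ[R] DirectedGraph.LeavittPathAlgebra.commutativeCore E R,
        IsConditionalExpectation (DirectedGraph.LeavittPathAlgebra.commutativeCore E R) F' →
        (∀ x ∈ DirectedGraph.LeavittPathAlgebra.normalGens E R,
          (F' x : E.LeavittPathAlgebra R) = x) →
        (∀ x ∈ DirectedGraph.LeavittPathAlgebra.standardGens E R \
            DirectedGraph.LeavittPathAlgebra.normalGens E R,
          (F' x : E.LeavittPathAlgebra R) = 0) →
        F' = F) ∧
      (∀ x : E.LeavittPathAlgebra R,
        E.aperiodicRep R (F x : E.LeavittPathAlgebra R) =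
          E.aperiodicExp R (E.aperiodicRep R x)) := by
  -- Over the zero ring all modules vanish. This case is separate because the description of normal
  -- elements by normal pairs was obtained from vertices being nonzero.
  rcases subsingleton_or_nontrivial R with hR | hR
  · have hL : Subsingleton (E.LeavittPathAlgebra R) := Module.subsingleton R _
    have hE : Subsingleton (E.gradedEnd R) := Module.subsingleton R _
    refine ⟨0, ⟨⟨fun b hb => star_mem_commutativeCore hb, fun a _ => ?_,
      fun a => Subsingleton.elim _ _, fun b => ⟨0, Subsingleton.elim _ _⟩,
      fun b a => Subsingleton.elim _ _⟩, fun x _ => Subsingleton.elim _ _,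
      fun x _ => Subsingleton.elim _ _⟩,
      fun F' _ _ _ => LinearMap.ext fun a => Subsingleton.elim _ _,
      fun x => Subsingleton.elim _ _⟩
    exact AddSubmonoid.zero_mem _
  obtain ⟨F, hF⟩ := exists_isCoreProjection E R
  let G : E.LeavittPathAlgebra R →ₗ[R] commutativeCore E R :=
    { toFun := fun a => ⟨F a, hF.mem_core a⟩
      map_add' := fun a b => Subtype.ext (map_add F a b)
      map_smul' := fun t a => Subtype.ext (map_smul F t a) }
  have hnormal : ∀ x ∈ normalGens E R, (G x : E.LeavittPathAlgebra R) = x := fun x hx =>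
    hF.eq_self (NonUnitalAlgebra.subset_adjoin R hx)
  have hzero : ∀ x ∈ standardGens E R \ normalGens E R, (G x : E.LeavittPathAlgebra R) = 0 :=
    fun x hx => (hF.eq_self_or_zero hx.1).resolve_left fun h => hx.2 h.1
  refine ⟨G, ⟨⟨fun b hb => star_mem_commutativeCore hb, fun a ha => hF.positive ha,
    fun a => Subtype.ext (hF.eq_self (hF.mem_core a)),
    fun b => ⟨b, Subtype.ext (hF.eq_self b.2)⟩,
    fun b a => Subtype.ext (hF.map_mul b.2 a)⟩, hnormal, hzero⟩, fun F' _ h h' => ?_,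
    fun x => hF.aperiodicRep_comp x⟩
  -- Uniqueness: `G_E` spans, and the values there are prescribed.
  refine linearMap_ext fun a ha => Subtype.ext ?_
  by_cases hn : a ∈ normalGens E R
  · rw [h a hn, hnormal a hn]
  · rw [h' a ⟨ha, hn⟩, hzero a ⟨ha, hn⟩]
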